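/- **Setting.** Let $N\ge 1$ be an integer, $\mathcal D$ a non-empty finite set (the secrets), $\mathcal M$ and $\mathcal V$ sets (the outer queries and the possible outputs), and let $\mathbf{tr}:\mathcal D\times\mathcal M\to[N]$ and $\mathbf{post}:\mathcal D\times[N]\to[N]$ be functions. Given a permutation $\sigma$ of $[N]$ and a secret $d\in\mathcal D$, the oracle $\mathcal O(\sigma,d)$ answers an *inner query* $i\in[N]$ by $\sigma(i)$ and an *outer query* $m\in\mathcal M$ by $\mathbf{post}(d,\sigma(\mathbf{tr}(d,m)))$; the game also specifies whether inner queries $i\in[N]$ to the inverse permutation, answered by $\sigma^{-1}(i)$, are permitted. A $0/1$ success predicate $\mathbf{suc}$ receives the secret, the output of an adversary and its queries with their answers. These data form a *permutation challenge game* $\mathbf{PC}$. A *non-preprocessing, non-adaptive algorithm* is deterministic: it issues a fixed finite sequence of permitted queries (independent of $\sigma$ and $d$), and outputs a value in $\mathcal V$ that is a function of the answers. A *non-adaptive $(S,T)$-algorithm with preprocessing* is a pair $(A_0,A_1)$, where $A_0$ maps every permutation $\sigma$ of $[N]$ to an advice string $z=A_0(\sigma)\in\{0,1\}^S$, and $A_1$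 assigns to every $z\in\{0,1\}^S$ an algorithm $(A_1)_z$ of the former kind that makes at most $T$ queries (inner and outer queries together); so the queries may depend on $z$, but not otherwise on $\sigma$ or $d$. Success probabilities are taken over a uniformly random permutation $\sigma$ of $[N]$ and an independent uniformly random $d\in\mathcal D$: a non-preprocessing algorithm is run with the oracle $\mathcal O(\sigma,d)$, the pair $(A_0,A_1)$ is run as $(A_1)_{A_0(\sigma)}$ with the oracle $\mathcal O(\sigma,d)$, and the run succeeds if $\mathbf{suc}$ returns $1$. Let $\mathbf{MaxS}(T)$ be the optimal (supremal) success probability of a non-preprocessing, non-adaptive algorithm that makes at most $T$ queries. **Theorem.** Let $u>0$ be a real number and $S,T\ge 0$ integers. Suppose that * $\mathbf{tr}$ is *$u$-uniform*: $|\{d\in\mathcal D : \mathbf{tr}(d,m)=j\}|\le |\mathcal D|/u$ for all $m\in\mathcal M$ and $j\in[N]$; * $\mathbf{suc}$ compares the output to a function of the secret: there are a set $\mathcal D'$, a function $g:\mathcal D\to\mathcal D'$ and a predicate $P:\mathcal D'\times\mathcal V\to\{0,1\}$ such that, on a secret $d$ and an output $v$, $\mathbf{suc}$ returns $P(g(d),v)$,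 whatever the queries and answers. Then every non-adaptive $(S,T)$-algorithm with preprocessing $(A_0,A_1)$ for $\mathbf{PC}$ has success probability at most $$ \min\left(2\cdot\mathbf{MaxS}(T)+\frac{4\ln(2)\,ST}{u}+\frac{T^2}{u},\ \ \mathbf{MaxS}(T)+\sqrt{\frac{\ln(2)\,ST}{u}}+\frac{T^2}{2u}\right). $$ -/

import Mathlib

noncomputable section

/-- An oracle query in a permutation challenge game over `[N]` (modelled as `Fin N`) with outer query
space `M`: an inner query to the permutation, an inner query to its inverse (which exists only when
`inv` holds, i.e. when the game permits inverse queries), or an outer query. -/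
inductive PCQuery (N : ℕ) (M : Type*) (inv : Prop) where
  | inner (i : Fin N)
  | innerInv (h : inv) (i : Fin N)
  | outer (m : M)

/-- A permutation challenge game with secret space `D`, outer query space `M` and output domain `V`.
`suc` is the 0/1 predicate that is applied after the adversary has been run: it receives the secret, the
output of the adversary and the list of the adversary's queries with their answers (but no advice
string). -/
structure PCGame (N : ℕ) (D M V : Type*) where
  /-- the translation function -/
  tr : D → M → Fin N
  /-- the post-processing function -/
  post : D → Fin N → Fin N
  /-- whether inner queries to the inverse permutation are permitted -/
  inverseAllowed : Prop
  /-- the predicate applied to the secret, the output and the query answers -/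
  suc : D → V → List (PCQuery N M inverseAllowed × Fin N) → Bool

namespace PCGame

variable {N : ℕ} {D M V : Type*}

/-- The queries that an adversary for `G` may issue. -/
abbrev Query (G : PCGame N D M V) : Type _ := PCQuery N M G.inverseAllowed

/-- The answer of the oracle `O(σ, d)` to a query. -/
def answer (G : PCGame N D M V) (σ : Equiv.Perm (Fin N)) (d : D) : G.Query → Fin N
  | .inner i => σ i
  | .innerInv _ i => σ.symm i
  | .outer m => G.post d (σ (G.tr d m))

/-- `u`-uniformity of the translation function. -/
def IsUniform [Fintype D] (G : PCGame N D M V) (u : ℝ) : Prop :=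
  ∀ (m : M) (j : Fin N),
    ((Finset.univ.filter fun d : D => G.tr d m = j).card : ℝ) ≤ (Fintype.card D : ℝ) / u

/-- The success predicate only compares the output of the adversary, by means of `cmp`, to the value
`g d` of a function of the secret `d`. -/
def ComparesOutputTo (G : PCGame N D M V) {W : Type*} (g : D → W) (cmp : W → V → Bool) : Prop :=
  ∀ (d : D) (v : V) (l : List (G.Query × Fin N)), G.suc d v l = cmp (g d) v

/-- A deterministic non-adaptive online algorithm (no advice): the list of its queries is fixed in
advance, and its output is a function of the list of the answers. -/
structure OnlineAlg (G : PCGame N D M V) where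
  queries : List G.Query
  output : List (Fin N) → V

/-- A deterministic non-adaptive algorithm with `S` bits of advice: `prep` computes the advice string
from the whole permutation; given the advice string, the online part is non-adaptive (its queries may
depend on the advice string only). -/
structure PrepAlg (G : PCGame N D M V) (S : ℕ) where
  prep : Equiv.Perm (Fin N) → (Fin S → Bool)
  online : (Fin S → Bool) → G.OnlineAlg

namespace OnlineAlg

variable {G : PCGame N D M V}

/-- The total number of (inner and outer) queries. -/
def numQueries (A : G.OnlineAlg) : ℕ := A.queries.length

/-- The value, for the permutation `σ` and the secret `d`, of the success predicate instantiated with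
the adversary `A`. -/
def succeeds (A : G.OnlineAlg) (σ : Equiv.Perm (Fin N)) (d : D) : Bool :=
  G.suc d (A.output (A.queries.map (G.answer σ d))) (A.queries.map fun q => (q, G.answer σ d q))

/-- The success probability, over a uniform permutation and an independent uniform secret. -/
def successProb [Fintype D] (A : G.OnlineAlg) : ℝ :=
  (∑ σ : Equiv.Perm (Fin N), ∑ d : D, if A.succeeds σ d then (1 : ℝ) else 0) /
    ((Fintype.card (Equiv.Perm (Fin N)) : ℝ) * (Fintype.card D : ℝ))

end OnlineAlg

namespace PrepAlg

variable {G : PCGame N D M V} {S : ℕ}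

/-- The online part makes at most `T` queries, i.e. the algorithm is an `(S, T)`-algorithm. -/
def MakesAtMost (A : G.PrepAlg S) (T : ℕ) : Prop :=
  ∀ z : Fin S → Bool, (A.online z).numQueries ≤ T

/-- The success probability, over a uniform permutation `σ` and an independent uniform secret, of the
online part run with the advice string computed from `σ`. -/
def successProb [Fintype D] (A : G.PrepAlg S) : ℝ :=
  (∑ σ : Equiv.Perm (Fin N), ∑ d : D,
      if (A.online (A.prep σ)).succeeds σ d then (1 : ℝ) else 0) /
    ((Fintype.card (Equiv.Perm (Fin N)) : ℝ) * (Fintype.card D : ℝ))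

end PrepAlg

/-- The optimal success probability of a non-preprocessing, non-adaptive algorithm that makes at most
`T` queries. -/
def maxS [Fintype D] (G : PCGame N D M V) (T : ℕ) : ℝ :=
  sSup {p : ℝ | ∃ A : G.OnlineAlg, A.numQueries ≤ T ∧ A.successProb = p}

/-- The set in the definition of `maxS` is bounded above, so that the supremum is a genuine one. -/
theorem bddAbove_successProb [Fintype D] (G : PCGame N D M V) (T : ℕ) :
    BddAbove {p : ℝ | ∃ A : G.OnlineAlg, A.numQueries ≤ T ∧ A.successProb = p} := by
  refine ⟨1, ?_⟩
  rintro p ⟨A, -, rfl⟩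
  refine div_le_one_of_le₀ ?_ (by positivity)
  calc (∑ σ : Equiv.Perm (Fin N), ∑ d : D, if A.succeeds σ d then (1 : ℝ) else 0)
      ≤ ∑ _σ : Equiv.Perm (Fin N), ∑ _d : D, (1 : ℝ) := by
        refine Finset.sum_le_sum fun σ _ => Finset.sum_le_sum fun d _ => ?_
        split_ifs <;> norm_num
    _ = _ := by simp

end PCGame

end

/-! Group the permutations by the advice and by the answers to the inner queries that this advice
selects. Prescribing the inner answers alone gives a coset `C` of the pointwise stabiliser of a set
`K` of positions; prescribing the advice too leaves a subset `E` of `C`. Averaged over all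
permutations, log(|C|/|E|) is at most S log 2 (`sum_log_card_div_card_le`): the advice costs
entropy, the inner answers do not.

On `C` the advice plays no role. There the online part is one fixed algorithm with hardwired inner
answers, which is legitimate because success ignores the transcript, and its mean success exceeds
MaxS(T) by at most T²/(2u) (`sum_mean_cell_le`).

To pass from `C` to `E`, note that for a fixed secret d success depends only on the values of the
permutation on the set X_d of outer positions, and uniformity makes X_d meet a given pair of
positions for at most a fraction 2T/u of the secrets. A Brascamp–Lieb inequality for uniform
permutations (`mean_fixing_prod_rpow_le`) then bounds the exponential moment of the weighted number
of successful secrets by a product of one-secret moments. A change of measure yields l·p ≤ (2T/u)·S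
log 2 plus the mean over d of log(1 + q_d(e^l - 1)), where p is the success probability and q_d the
success rate on `C`; two choices of l give the two bounds.

The Brascamp–Lieb inequality is proved by revealing where one value sits after another. Each
revelation is a Hölder inequality for one uniform position (`mean_prod_rpow_le`), dual to a
subadditivity of entropy under averaging a density outside X_d. Along the segment from the constant
1 to the density, the derivative of entropy is a Dirichlet form over pairs; averaging outside a set
bounds that form by the pairs that meet the set. Hence the condition on pairs of positions. -/

noncomputable section
-- Entropy under averaging outside a set, and the dual Hölder inequality.
/-- The difference of two numbers times the difference of their logarithms. -/
def logGap (a b : ℝ) : ℝ := (a - b) * (Real.log a - Real.log b)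

theorem logGap_self (a : ℝ) : logGap a a = 0 := by simp [logGap]

theorem logGap_comm (a b : ℝ) : logGap a b = logGap b a := by unfold logGap; ring

theorem logGap_nonneg {a b : ℝ} (ha : 0 < a) (hb : 0 < b) : 0 ≤ logGap a b := by
  unfold logGap
  rcases le_total a b with h | h
  · exact mul_nonneg_of_nonpos_of_nonpos (by linarith) (by linarith [Real.log_le_log ha h])
  · exact mul_nonneg (by linarith) (by linarith [Real.log_le_log hb h])

/-- The tangent line bound for the convex function `logGap a`. -/
theorem logGap_tangent {a b m : ℝ} (ha : 0 < a) (hb : 0 < b) (hm : 0 < m) :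
    logGap a m + (b - m) * (Real.log m - Real.log a - a / m + 1) ≤ logGap a b := by
  have h1 : Real.log b - Real.log m ≤ b / m - 1 := by
    rw [← Real.log_div hb.ne' hm.ne']
    exact Real.log_le_sub_one_of_pos (by positivity)
  have h2 : Real.log m - Real.log b ≤ m / b - 1 := by
    rw [← Real.log_div hm.ne' hb.ne']
    exact Real.log_le_sub_one_of_pos (by positivity)
  have h3 : a * (Real.log b - Real.log m) ≤ a * (b / m - 1) := by gcongr
  have h4 : b * (Real.log m - Real.log b) ≤ b * (m / b - 1) := by gcongr
  have h5 : b * (m / b - 1) = m - b := by field_simp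
  have h6 : (b - m) * (a / m) = a * (b / m - 1) := by field_simp
  unfold logGap
  nlinarith

/-- Jensen's inequality: on summing the tangent lines at the mean, the linear terms cancel. -/
theorem card_mul_logGap_mean_le {ι : Type*} {s : Finset ι} (hs : s.Nonempty) {f : ι → ℝ}
    (hf : ∀ i ∈ s, 0 < f i) {a : ℝ} (ha : 0 < a) :
    (s.card : ℝ) * logGap a ((∑ i ∈ s, f i) / s.card) ≤ ∑ i ∈ s, logGap a (f i) := by
  set m : ℝ := (∑ i ∈ s, f i) / s.card with hm_def
  have hc : (0 : ℝ) < s.card := by exact_mod_cast hs.card_pos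
  have hm : 0 < m := div_pos (Finset.sum_pos hf hs) hc
  have h := Finset.sum_le_sum fun i hi => logGap_tangent ha (hf i hi) hm
  rw [Finset.sum_add_distrib, ← Finset.sum_mul, Finset.sum_sub_distrib] at h
  have h0 : ∑ i ∈ s, f i = s.card * m := by rw [hm_def]; field_simp
  simpa [h0] using h

/-- The function on `s` that agrees with `f` on `X` and is the mean of `f` outside `X`. -/
def averageOff {ι : Type*} [DecidableEq ι] (s X : Finset ι) (f : ι → ℝ) (i : ι) : ℝ :=
  if i ∈ X then f i else (∑ j ∈ s \ X, f j) / (s \ X).card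

section averageOff

variable {ι : Type*} [DecidableEq ι] {s X : Finset ι} {f : ι → ℝ}

theorem averageOff_of_mem {i : ι} (hi : i ∈ X) : averageOff s X f i = f i := if_pos hi

theorem averageOff_of_notMem {i : ι} (hi : i ∉ X) :
    averageOff s X f i = (∑ j ∈ s \ X, f j) / (s \ X).card := if_neg hi

theorem averageOff_pos (hf : ∀ i ∈ s, 0 < f i) {i : ι} (hi : i ∈ s) : 0 < averageOff s X f i := by
  by_cases h : i ∈ X
  · rw [averageOff_of_mem h]; exact hf i hi
  · rw [averageOff_of_notMem h]
    have hne : (s \ X).Nonempty := ⟨i, by simp [hi, h]⟩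
    exact div_pos (Finset.sum_pos (fun j hj => hf j (Finset.mem_sdiff.1 hj).1) hne)
      (by exact_mod_cast hne.card_pos)

theorem sum_eq_inter_add_sdiff (g : ι → ℝ) :
    ∑ i ∈ s, g i = ∑ i ∈ s ∩ X, g i + ∑ i ∈ s \ X, g i :=
  (Finset.sum_inter_add_sum_sdiff s X g).symm

/-- Collapsing is self-adjoint against functions that are constant outside `X`. -/
theorem sum_averageOff_mul {φ : ι → ℝ} (hφ : ∀ i ∈ s \ X, ∀ j ∈ s \ X, φ i = φ j) :
    ∑ i ∈ s, averageOff s X f i * φ i = ∑ i ∈ s, f i * φ i := by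
  rw [sum_eq_inter_add_sdiff (X := X), sum_eq_inter_add_sdiff (X := X) fun i => f i * φ i]
  congr 1
  · exact Finset.sum_congr rfl fun i hi => by rw [averageOff_of_mem (Finset.mem_inter.1 hi).2]
  · rcases (s \ X).eq_empty_or_nonempty with h | ⟨k, hk⟩
    · simp [h]
    · have hc : ((s \ X).card : ℝ) ≠ 0 := by
        exact_mod_cast (Finset.card_pos.2 ⟨k, hk⟩).ne'
      have e1 : ∑ i ∈ s \ X, f i * φ i = (∑ i ∈ s \ X, f i) * φ k := by
        rw [Finset.sum_mul]
        exact Finset.sum_congr rfl fun i hi => by rw [hφ i hi k hk]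
      have e2 : ∑ i ∈ s \ X, averageOff s X f i * φ i
          = ∑ i ∈ s \ X, ((∑ j ∈ s \ X, f j) / (s \ X).card) * φ k :=
        Finset.sum_congr rfl fun i hi => by
          rw [hφ i hi k hk, averageOff_of_notMem (Finset.mem_sdiff.1 hi).2]
      rw [e1, e2, Finset.sum_const, nsmul_eq_mul]
      field_simp

theorem sum_averageOff : ∑ i ∈ s, averageOff s X f i = ∑ i ∈ s, f i := by
  simpa using sum_averageOff_mul (s := s) (X := X) (f := f) (φ := fun _ => 1) (by simp)

theorem averageOff_lerp (r : ℝ) {i : ι} (hi : i ∈ s) :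
    averageOff s X (fun j => 1 + r * (f j - 1)) i = 1 + r * (averageOff s X f i - 1) := by
  by_cases h : i ∈ X
  · simp [averageOff_of_mem h]
  · rw [averageOff_of_notMem h, averageOff_of_notMem h]
    have hc : ((s \ X).card : ℝ) ≠ 0 := by
      have : (s \ X).Nonempty := ⟨i, by simp [hi, h]⟩
      exact_mod_cast this.card_pos.ne'
    simp only [Finset.sum_add_distrib, ← Finset.mul_sum, Finset.sum_sub_distrib, Finset.sum_const,
      nsmul_eq_mul]
    field_simp

/-- Pairs with both points outside `X` contribute nothing after averaging, pairs inside `X` are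
untouched, and mixed pairs do not increase in total by Jensen's inequality. -/
theorem sum_logGap_averageOff_le (hf : ∀ i ∈ s, 0 < f i) :
    ∑ i ∈ s, ∑ j ∈ s, logGap (averageOff s X f i) (averageOff s X f j) ≤
      ∑ i ∈ s, ∑ j ∈ s, if i ∈ X ∨ j ∈ X then logGap (f i) (f j) else 0 := by
  have key : ∀ i ∈ s ∩ X, ∑ j ∈ s \ X, logGap (f i) (averageOff s X f j) ≤
      ∑ j ∈ s \ X, logGap (f i) (f j) := by
    intro i hi
    rcases (s \ X).eq_empty_or_nonempty with h | h
    · simp [h]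
    · refine le_trans (le_of_eq ?_) (card_mul_logGap_mean_le h
        (fun j hj => hf j (Finset.mem_sdiff.1 hj).1) (hf i (Finset.mem_inter.1 hi).1))
      rw [Finset.sum_congr rfl fun j hj => by rw [averageOff_of_notMem (Finset.mem_sdiff.1 hj).2]]
      simp
  have hL : ∑ i ∈ s, ∑ j ∈ s, logGap (averageOff s X f i) (averageOff s X f j) =
      ∑ i ∈ s ∩ X, ∑ j ∈ s ∩ X, logGap (f i) (f j) +
        2 * ∑ i ∈ s ∩ X, ∑ j ∈ s \ X, logGap (f i) (averageOff s X f j) := by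
    have a1 : ∀ i ∈ s ∩ X, ∑ j ∈ s, logGap (averageOff s X f i) (averageOff s X f j) =
        ∑ j ∈ s ∩ X, logGap (f i) (f j) + ∑ j ∈ s \ X, logGap (f i) (averageOff s X f j) := by
      intro i hi
      rw [sum_eq_inter_add_sdiff (X := X), averageOff_of_mem (Finset.mem_inter.1 hi).2]
      congr 1
      exact Finset.sum_congr rfl fun j hj => by rw [averageOff_of_mem (Finset.mem_inter.1 hj).2]
    have a2 : ∀ i ∈ s \ X, ∑ j ∈ s, logGap (averageOff s X f i) (averageOff s X f j) =
        ∑ j ∈ s ∩ X, logGap (f j) (averageOff s X f i) := by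
      intro i hi
      rw [sum_eq_inter_add_sdiff (X := X)]
      have z : ∑ j ∈ s \ X, logGap (averageOff s X f i) (averageOff s X f j) = 0 :=
        Finset.sum_eq_zero fun j hj => by
          rw [averageOff_of_notMem (Finset.mem_sdiff.1 hi).2,
            averageOff_of_notMem (Finset.mem_sdiff.1 hj).2, logGap_self]
      rw [z, add_zero]
      exact Finset.sum_congr rfl fun j hj => by
        rw [averageOff_of_mem (Finset.mem_inter.1 hj).2, logGap_comm]
    rw [sum_eq_inter_add_sdiff (X := X), Finset.sum_congr rfl a1, Finset.sum_congr rfl a2,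
      Finset.sum_add_distrib, Finset.sum_comm (s := s \ X)]
    ring
  have hR : (∑ i ∈ s, ∑ j ∈ s, if i ∈ X ∨ j ∈ X then logGap (f i) (f j) else 0) =
      ∑ i ∈ s ∩ X, ∑ j ∈ s ∩ X, logGap (f i) (f j) +
        2 * ∑ i ∈ s ∩ X, ∑ j ∈ s \ X, logGap (f i) (f j) := by
    have a1 : ∀ i ∈ s ∩ X, (∑ j ∈ s, if i ∈ X ∨ j ∈ X then logGap (f i) (f j) else 0) =
        ∑ j ∈ s ∩ X, logGap (f i) (f j) + ∑ j ∈ s \ X, logGap (f i) (f j) := by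
      intro i hi
      simp only [(Finset.mem_inter.1 hi).2, true_or, if_true]
      exact sum_eq_inter_add_sdiff _
    have a2 : ∀ i ∈ s \ X, (∑ j ∈ s, if i ∈ X ∨ j ∈ X then logGap (f i) (f j) else 0) =
        ∑ j ∈ s ∩ X, logGap (f j) (f i) := by
      intro i hi
      rw [sum_eq_inter_add_sdiff (X := X)]
      have z : (∑ j ∈ s \ X, if i ∈ X ∨ j ∈ X then logGap (f i) (f j) else 0) = 0 :=
        Finset.sum_eq_zero fun j hj => by
          simp [(Finset.mem_sdiff.1 hi).2, (Finset.mem_sdiff.1 hj).2]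
      rw [z, add_zero]
      exact Finset.sum_congr rfl fun j hj => by
        simp [(Finset.mem_inter.1 hj).2, logGap_comm]
    rw [sum_eq_inter_add_sdiff (X := X), Finset.sum_congr rfl a1, Finset.sum_congr rfl a2,
      Finset.sum_add_distrib, Finset.sum_comm (s := s \ X)]
    ring
  rw [hL, hR]
  have := Finset.sum_le_sum key
  linarith

/-- The cross terms of the expanded double sum vanish because the deviations `f i - 1` sum to zero.
-/
theorem sum_logGap_eq {ι : Type*} {s : Finset ι} {f : ι → ℝ} (h1 : ∑ i ∈ s, (f i - 1) = 0) :
    ∑ i ∈ s, ∑ j ∈ s, logGap (f i) (f j) =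
      2 * s.card * ∑ i ∈ s, (f i - 1) * Real.log (f i) := by
  obtain ⟨a, ha⟩ : ∃ a : ι → ℝ, ∀ i, f i - 1 = a i := ⟨_, fun _ => rfl⟩
  have e : ∀ i j, logGap (f i) (f j) = a i * Real.log (f i) + a j * Real.log (f j)
      - a i * Real.log (f j) - Real.log (f i) * a j := by
    intro i j; rw [← ha, ← ha]; unfold logGap; ring
  simp only [ha] at h1
  simp only [ha, e, Finset.sum_sub_distrib, Finset.sum_add_distrib, ← Finset.mul_sum,
    ← Finset.sum_mul, Finset.sum_const, nsmul_eq_mul, h1]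
  have e' : ∑ i ∈ s, a i * (s.card * Real.log (f i)) = s.card * ∑ i ∈ s, a i * Real.log (f i) := by
    rw [Finset.mul_sum]
    exact Finset.sum_congr rfl fun i _ => by ring
  rw [e']
  ring

variable {D : Type*} [Fintype D] {e : D → ℝ} {Z : D → Finset ι}

/-- Subadditivity of the entropy production under collapsing. -/
theorem sum_mul_sum_log_averageOff_le (he : ∀ d, 0 ≤ e d)
    (hpair : ∀ i ∈ s, ∀ j ∈ s, i ≠ j → ∑ d, (if i ∈ Z d ∨ j ∈ Z d then e d else 0) ≤ 1)
    (hf : ∀ i ∈ s, 0 < f i) (h1 : ∑ i ∈ s, (f i - 1) = 0) :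
    ∑ d, e d * ∑ i ∈ s, (averageOff s (Z d) f i - 1) * Real.log (averageOff s (Z d) f i) ≤
      ∑ i ∈ s, (f i - 1) * Real.log (f i) := by
  rcases s.eq_empty_or_nonempty with rfl | hs
  · simp
  have hc : (0 : ℝ) < 2 * s.card := by
    have : (0 : ℝ) < s.card := by exact_mod_cast hs.card_pos
    positivity
  refine le_of_mul_le_mul_left ?_ hc
  rw [← sum_logGap_eq h1, Finset.mul_sum]
  calc ∑ d, 2 * (s.card : ℝ) *
        (e d * ∑ i ∈ s, (averageOff s (Z d) f i - 1) * Real.log (averageOff s (Z d) f i))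
      = ∑ d, e d * ∑ i ∈ s, ∑ j ∈ s, logGap (averageOff s (Z d) f i) (averageOff s (Z d) f j) := by
        refine Finset.sum_congr rfl fun d _ => ?_
        rw [sum_logGap_eq]
        · ring
        · rw [Finset.sum_sub_distrib, sum_averageOff, ← Finset.sum_sub_distrib, h1]
    _ ≤ ∑ d, e d * ∑ i ∈ s, ∑ j ∈ s, if i ∈ Z d ∨ j ∈ Z d then logGap (f i) (f j) else 0 :=
        Finset.sum_le_sum fun d _ =>
          mul_le_mul_of_nonneg_left (sum_logGap_averageOff_le hf) (he d)
    _ = ∑ i ∈ s, ∑ j ∈ s, (∑ d, if i ∈ Z d ∨ j ∈ Z d then e d else 0) * logGap (f i) (f j) := by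
        simp only [Finset.mul_sum, Finset.sum_mul]
        rw [Finset.sum_comm]
        refine Finset.sum_congr rfl fun i _ => ?_
        rw [Finset.sum_comm]
        refine Finset.sum_congr rfl fun j _ => Finset.sum_congr rfl fun d _ => ?_
        split_ifs <;> simp
    _ ≤ ∑ i ∈ s, ∑ j ∈ s, logGap (f i) (f j) := by
        refine Finset.sum_le_sum fun i hi => Finset.sum_le_sum fun j hj => ?_
        by_cases h : i = j
        · subst h; simp [logGap_self]
        · exact mul_le_of_le_one_left (logGap_nonneg (hf i hi) (hf j hj)) (hpair i hi j hj h)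

theorem hasDerivAt_sum_lerp_mul_log {ι : Type*} {s : Finset ι} {g : ι → ℝ} (h1 : ∑ i ∈ s, (g i - 1) = 0) {r : ℝ}
    (hr : ∀ i ∈ s, 0 < 1 + r * (g i - 1)) :
    HasDerivAt (fun x => ∑ i ∈ s, (1 + x * (g i - 1)) * Real.log (1 + x * (g i - 1)))
      (∑ i ∈ s, (g i - 1) * Real.log (1 + r * (g i - 1))) r := by
  have h : ∀ i ∈ s, HasDerivAt (fun x => (1 + x * (g i - 1)) * Real.log (1 + x * (g i - 1)))
      ((Real.log (1 + r * (g i - 1)) + 1) * (g i - 1)) r := by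
    intro i hi
    have a : HasDerivAt (fun x : ℝ => 1 + x * (g i - 1)) (g i - 1) r := by
      simpa using ((hasDerivAt_id r).mul_const (g i - 1)).const_add 1
    exact (Real.hasDerivAt_mul_log (hr i hi).ne').comp r a
  refine (HasDerivAt.fun_sum h).congr_deriv ?_
  simp only [add_mul, one_mul, Finset.sum_add_distrib, h1, add_zero]
  exact Finset.sum_congr rfl fun i _ => mul_comm _ _

theorem lerp_pos {x r : ℝ} (hx : 0 < x) (h0 : 0 ≤ r) (h1 : r ≤ 1) : 0 < 1 + r * (x - 1) := by
  rcases h1.lt_or_eq with h | rfl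
  · nlinarith [mul_nonneg h0 hx.le]
  · linarith

/-- Subadditivity of entropy under collapsing: a Shearer-type inequality in which a set counts for
each pair of points that it meets. -/
theorem sum_mul_sum_mul_log_averageOff_le (he : ∀ d, 0 ≤ e d)
    (hpair : ∀ i ∈ s, ∀ j ∈ s, i ≠ j → ∑ d, (if i ∈ Z d ∨ j ∈ Z d then e d else 0) ≤ 1)
    (hf : ∀ i ∈ s, 0 < f i) (h1 : ∑ i ∈ s, (f i - 1) = 0) :
    ∑ d, e d * ∑ i ∈ s, averageOff s (Z d) f i * Real.log (averageOff s (Z d) f i) ≤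
      ∑ i ∈ s, f i * Real.log (f i) := by
  have hc1 : ∀ d, ∑ i ∈ s, (averageOff s (Z d) f i - 1) = 0 := fun d => by
    rw [Finset.sum_sub_distrib, sum_averageOff, ← Finset.sum_sub_distrib, h1]
  set Ψ : ℝ → ℝ := fun x => ∑ i ∈ s, (1 + x * (f i - 1)) * Real.log (1 + x * (f i - 1)) -
    ∑ d, e d * ∑ i ∈ s, (1 + x * (averageOff s (Z d) f i - 1)) *
      Real.log (1 + x * (averageOff s (Z d) f i - 1)) with hΨ
  have hder : ∀ r ∈ Set.Icc (0 : ℝ) 1, HasDerivAt Ψ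
      (∑ i ∈ s, (f i - 1) * Real.log (1 + r * (f i - 1)) - ∑ d, e d * ∑ i ∈ s,
        (averageOff s (Z d) f i - 1) * Real.log (1 + r * (averageOff s (Z d) f i - 1))) r := by
    rintro r ⟨hr0, hr1⟩
    refine (hasDerivAt_sum_lerp_mul_log h1 fun i hi => lerp_pos (hf i hi) hr0 hr1).sub ?_
    refine HasDerivAt.fun_sum fun d _ => HasDerivAt.const_mul _ ?_
    exact hasDerivAt_sum_lerp_mul_log (hc1 d) fun i hi => lerp_pos (averageOff_pos hf hi) hr0 hr1
  have hmono : MonotoneOn Ψ (Set.Icc 0 1) := by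
    refine monotoneOn_of_hasDerivWithinAt_nonneg (convex_Icc 0 1)
      (fun r hr => (hder r hr).continuousAt.continuousWithinAt)
      (fun r hr => (hder r (interior_subset hr)).hasDerivWithinAt) ?_
    intro r hr
    rw [interior_Icc] at hr
    obtain ⟨hr0, hr1⟩ := hr
    -- The interpolant is a density too, and averaging commutes with interpolation; both sides then
    -- carry a factor `r`, which is positive in the interior.
    have h := sum_mul_sum_log_averageOff_le (f := fun i => 1 + r * (f i - 1)) he hpair
      (fun i hi => lerp_pos (hf i hi) hr0.le hr1.le)
      (by simp only [add_sub_cancel_left, ← Finset.mul_sum, h1, mul_zero])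
    have e1 : ∀ d, ∑ i ∈ s, (averageOff s (Z d) (fun j => 1 + r * (f j - 1)) i - 1) *
        Real.log (averageOff s (Z d) (fun j => 1 + r * (f j - 1)) i) = r * ∑ i ∈ s,
          (averageOff s (Z d) f i - 1) * Real.log (1 + r * (averageOff s (Z d) f i - 1)) := by
      intro d
      rw [Finset.mul_sum]
      refine Finset.sum_congr rfl fun i hi => ?_
      rw [averageOff_lerp r hi]; ring
    simp only [e1, add_sub_cancel_left] at h
    have e2 : ∑ i ∈ s, r * (f i - 1) * Real.log (1 + r * (f i - 1)) =
        r * ∑ i ∈ s, (f i - 1) * Real.log (1 + r * (f i - 1)) := by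
      rw [Finset.mul_sum]; exact Finset.sum_congr rfl fun i _ => by ring
    have e3 : ∀ c : D → ℝ, ∑ d, e d * (r * c d) = r * ∑ d, e d * c d := fun c => by
      rw [Finset.mul_sum]; exact Finset.sum_congr rfl fun d _ => by ring
    rw [e2, e3] at h
    exact sub_nonneg.2 (le_of_mul_le_mul_left h hr0)
  -- At 0 every logarithm is log 1, so the gap vanishes; at 1 it is the claimed difference.
  have h := hmono (Set.left_mem_Icc.2 zero_le_one) (Set.right_mem_Icc.2 zero_le_one) zero_le_one
  simp only [hΨ, zero_mul, add_zero, Real.log_one, mul_zero, Finset.sum_const_zero, sub_zero,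
    one_mul, add_sub_cancel] at h
  linarith

/-- A Hölder-type inequality on a finite set, dual to `sum_mul_sum_mul_log_averageOff_le`. -/
theorem mean_prod_rpow_le (hs : s.Nonempty) (he : ∀ d, 0 ≤ e d)
    (hpair : ∀ i ∈ s, ∀ j ∈ s, i ≠ j → ∑ d, (if i ∈ Z d ∨ j ∈ Z d then e d else 0) ≤ 1)
    {φ : D → ι → ℝ} (hφ : ∀ d, ∀ i ∈ s, 0 < φ d i)
    (hconst : ∀ d, ∀ i ∈ s \ Z d, ∀ j ∈ s \ Z d, φ d i = φ d j) :
    (∑ i ∈ s, ∏ d, φ d i ^ e d) / s.card ≤ ∏ d, ((∑ i ∈ s, φ d i) / s.card) ^ e d := by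
  have hc : (0 : ℝ) < s.card := by exact_mod_cast hs.card_pos
  set P : ι → ℝ := fun i => ∏ d, φ d i ^ e d with hP
  have hPpos : ∀ i ∈ s, 0 < P i := fun i hi =>
    Finset.prod_pos fun d _ => Real.rpow_pos_of_pos (hφ d i hi) _
  set M : ℝ := (∑ i ∈ s, P i) / s.card with hM
  have hMpos : 0 < M := div_pos (Finset.sum_pos hPpos hs) hc
  set m : D → ℝ := fun d => (∑ i ∈ s, φ d i) / s.card with hm
  have hmpos : ∀ d, 0 < m d := fun d => div_pos (Finset.sum_pos (hφ d) hs) hc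
  -- The normalised product is the density for which the entropy duality is tight.
  set f : ι → ℝ := fun i => P i / M with hf
  have hfpos : ∀ i ∈ s, 0 < f i := fun i hi => div_pos (hPpos i hi) hMpos
  have hPsum : ∑ i ∈ s, P i = s.card * M := by rw [hM]; field_simp
  have hfsum : ∑ i ∈ s, f i = s.card := by
    rw [hf, ← Finset.sum_div, hPsum]; field_simp
  have h1 : ∑ i ∈ s, (f i - 1) = 0 := by
    rw [Finset.sum_sub_distrib, hfsum]; simp
  -- As `φ d` is constant off `Z d`, testing against `f` or against its average gives the same sum;
  -- nonnegativity of relative entropy does the rest.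
  have gibbs : ∀ d, ∑ i ∈ s, f i * Real.log (φ d i / m d) ≤
      ∑ i ∈ s, averageOff s (Z d) f i * Real.log (averageOff s (Z d) f i) := by
    intro d
    rw [← sum_averageOff_mul (X := Z d) (φ := fun i => Real.log (φ d i / m d))
      (fun i hi j hj => by rw [hconst d i hi j hj]), ← sub_nonpos, ← Finset.sum_sub_distrib]
    have b : ∀ i ∈ s, averageOff s (Z d) f i * Real.log (φ d i / m d) -
        averageOff s (Z d) f i * Real.log (averageOff s (Z d) f i) ≤
          φ d i / m d - averageOff s (Z d) f i := by
      intro i hi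
      have hq := averageOff_pos (X := Z d) hfpos hi
      have hy : 0 < φ d i / m d := div_pos (hφ d i hi) (hmpos d)
      rw [← mul_sub, ← Real.log_div hy.ne' hq.ne']
      calc _ ≤ averageOff s (Z d) f i * (φ d i / m d / averageOff s (Z d) f i - 1) := by
            gcongr
            exact Real.log_le_sub_one_of_pos (by positivity)
        _ = _ := by field_simp
    refine (Finset.sum_le_sum b).trans (le_of_eq ?_)
    rw [Finset.sum_sub_distrib, sum_averageOff, hfsum, ← Finset.sum_div, sub_eq_zero,
      div_eq_iff (hmpos d).ne']
    exact (mul_div_cancel₀ _ hc.ne').symm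
  have hent := sum_mul_sum_mul_log_averageOff_le he hpair hfpos h1
  have hlog : ∀ i ∈ s, ∑ d, e d * Real.log (φ d i / m d) =
      Real.log (f i) + (Real.log M - ∑ d, e d * Real.log (m d)) := by
    intro i hi
    have a : Real.log (P i) = ∑ d, e d * Real.log (φ d i) := by
      rw [hP, Real.log_prod fun d _ => (Real.rpow_pos_of_pos (hφ d i hi) _).ne']
      exact Finset.sum_congr rfl fun d _ => Real.log_rpow (hφ d i hi) _
    rw [hf, Real.log_div (hPpos i hi).ne' hMpos.ne', a]
    rw [Finset.sum_congr rfl fun d _ => by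
      rw [Real.log_div (hφ d i hi).ne' (hmpos d).ne', mul_sub], Finset.sum_sub_distrib]
    ring
  have hsum : ∑ d, e d * ∑ i ∈ s, f i * Real.log (φ d i / m d) =
      ∑ i ∈ s, f i * Real.log (f i) + s.card * (Real.log M - ∑ d, e d * Real.log (m d)) := by
    rw [← hfsum, Finset.sum_mul, ← Finset.sum_add_distrib]
    simp only [Finset.mul_sum]
    rw [Finset.sum_comm]
    refine Finset.sum_congr rfl fun i hi => ?_
    rw [← mul_add, ← hlog i hi, Finset.mul_sum]
    exact Finset.sum_congr rfl fun d _ => by ring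
  have hle : ∑ d, e d * ∑ i ∈ s, f i * Real.log (φ d i / m d) ≤ ∑ i ∈ s, f i * Real.log (f i) :=
    (Finset.sum_le_sum fun d _ => mul_le_mul_of_nonneg_left (gibbs d) (he d)).trans hent
  have hfin : Real.log M ≤ ∑ d, e d * Real.log (m d) := by
    rw [hsum] at hle
    have : (s.card : ℝ) * (Real.log M - ∑ d, e d * Real.log (m d)) ≤ 0 := by linarith
    nlinarith
  have hQ : Real.log (∏ d, m d ^ e d) = ∑ d, e d * Real.log (m d) := by
    rw [Real.log_prod fun d _ => (Real.rpow_pos_of_pos (hmpos d) _).ne']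
    exact Finset.sum_congr rfl fun d _ => Real.log_rpow (hmpos d) _
  rw [← hQ] at hfin
  exact (Real.log_le_log_iff hMpos
    (Finset.prod_pos fun d _ => Real.rpow_pos_of_pos (hmpos d) _)).1 hfin

end averageOff

end

/-! ### Permutations fixing a set: the Brascamp–Lieb inequality and the effect of conditioning. -/

noncomputable section

/-- The permutations that fix every point of `K`. -/
def fixing {α : Type*} [Fintype α] [DecidableEq α] (K : Finset α) : Finset (Equiv.Perm α) :=
  Finset.univ.filter fun σ => ∀ k ∈ K, σ k = k

section restriction

variable {α : Type*} {X : Finset α}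

/-- `F σ` depends only on the restriction of the permutation `σ` to `X`. -/
def DependsOnRestriction {β : Type*} (X : Finset α) (F : Equiv.Perm α → β) : Prop :=
  ∀ ⦃σ τ : Equiv.Perm α⦄, (∀ x ∈ X, σ x = τ x) → F σ = F τ

theorem DependsOnRestriction.mul_right {F : Equiv.Perm α → ℝ} (hF : DependsOnRestriction X F)
    (g : Equiv.Perm α) : DependsOnRestriction (X.map g.toEmbedding) fun τ => F (τ * g) := by
  intro σ τ h
  refine hF fun x hx => h (g x) ?_
  exact Finset.mem_map_of_mem _ hx

theorem DependsOnRestriction.mul_left {β : Type*} {F : Equiv.Perm α → β}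
    (hF : DependsOnRestriction X F) (g : Equiv.Perm α) :
    DependsOnRestriction X fun τ => F (g * τ) :=
  fun _ _ h => hF fun x hx => congrArg g (h x hx)

theorem DependsOnRestriction.comp {β γ : Type*} {F : Equiv.Perm α → β}
    (hF : DependsOnRestriction X F) (h : β → γ) : DependsOnRestriction X fun τ => h (F τ) :=
  fun _ _ hστ => congrArg h (hF hστ)

end restriction

section fixing

variable {α : Type*} [Fintype α] [DecidableEq α] {K X : Finset α}

theorem mem_fixing {σ : Equiv.Perm α} : σ ∈ fixing K ↔ ∀ k ∈ K, σ k = k := by simp [fixing]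

theorem one_mem_fixing : (1 : Equiv.Perm α) ∈ fixing K := mem_fixing.2 fun _ _ => rfl

theorem fixing_nonempty : (fixing K).Nonempty := ⟨1, one_mem_fixing⟩

theorem card_fixing_pos : (0 : ℝ) < (fixing K).card := by
  exact_mod_cast Finset.card_pos.2 fixing_nonempty

theorem fixing_empty : fixing (∅ : Finset α) = Finset.univ := by simp [fixing]

theorem fixing_of_compl_eq_empty (h : Kᶜ = ∅) : fixing K = {1} := by
  rw [Finset.compl_eq_empty_iff] at h
  subst h
  ext σ
  simp [mem_fixing, Equiv.Perm.ext_iff]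

theorem sum_fixing_mul_right {g : Equiv.Perm α} (hg : g ∈ fixing K) (F : Equiv.Perm α → ℝ) :
    ∑ τ ∈ fixing K, F (τ * g) = ∑ τ ∈ fixing K, F τ := by
  refine Finset.sum_equiv (Equiv.mulRight g) (fun τ => ?_) (fun τ _ => rfl)
  simp only [mem_fixing, Equiv.coe_mulRight, Equiv.Perm.mul_apply] at hg ⊢
  exact forall₂_congr fun k hk => by rw [hg k hk]

/-- Splitting the permutations fixing `K` according to the position of the value `v`. -/
theorem sum_fixing {v : α} (hv : v ∉ K) (F : Equiv.Perm α → ℝ) :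
    ∑ σ ∈ fixing K, F σ =
      ∑ i ∈ Kᶜ, ∑ τ ∈ fixing (insert v K), F (τ * Equiv.swap v i) := by
  rw [← Finset.sum_fiberwise_of_maps_to (s := fixing K) (t := Kᶜ) (g := fun σ => σ.symm v)]
  · refine Finset.sum_congr rfl fun i hi => ?_
    rw [Finset.mem_compl] at hi
    have hsw : ∀ k ∈ K, Equiv.swap v i k = k := fun k hk =>
      Equiv.swap_apply_of_ne_of_ne (by rintro rfl; exact hv hk) (by rintro rfl; exact hi hk)
    refine Finset.sum_nbij' (fun σ => σ * Equiv.swap v i) (fun τ => τ * Equiv.swap v i)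
      ?_ ?_ (fun σ _ => by simp) (fun σ _ => by simp) (fun σ _ => by simp)
    · intro σ hσ
      rw [Finset.mem_filter, mem_fixing] at hσ
      obtain ⟨h1, h2⟩ := hσ
      rw [mem_fixing]
      intro k hk
      rcases Finset.mem_insert.1 hk with rfl | hk
      · rw [← h2]; simp
      · rw [Equiv.Perm.mul_apply, hsw k hk, h1 k hk]
    · intro τ hτ
      rw [mem_fixing] at hτ
      rw [Finset.mem_filter, mem_fixing]
      refine ⟨fun k hk => ?_, ?_⟩
      · rw [Equiv.Perm.mul_apply, hsw k hk, hτ k (Finset.mem_insert_of_mem hk)]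
      · rw [Equiv.symm_apply_eq, Equiv.Perm.mul_apply, Equiv.swap_apply_right,
          hτ v (Finset.mem_insert_self _ _)]
  · intro σ hσ
    rw [mem_fixing] at hσ
    rw [Finset.mem_compl]
    intro h
    have := hσ _ h
    rw [Equiv.apply_symm_apply] at this
    exact hv (this ▸ h)

theorem card_fixing {v : α} (hv : v ∉ K) :
    ((fixing K).card : ℝ) = (Kᶜ.card : ℝ) * (fixing (insert v K)).card := by
  simpa using sum_fixing hv fun _ => 1

/-- Where the value `v` sits outside `X` is invisible to `F`: the two swaps differ by an element of
the stabiliser and the transposition of `i` and `j`, which does not move `X`. This is the constancy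
that `mean_prod_rpow_le` asks for. -/
theorem sum_fixing_swap_eq {v : α} (hv : v ∉ K) {F : Equiv.Perm α → ℝ}
    (hF : DependsOnRestriction X F) {i j : α} (hi : i ∈ Kᶜ \ X) (hj : j ∈ Kᶜ \ X) :
    ∑ τ ∈ fixing (insert v K), F (τ * Equiv.swap v i) =
      ∑ τ ∈ fixing (insert v K), F (τ * Equiv.swap v j) := by
  simp only [Finset.mem_sdiff, Finset.mem_compl] at hi hj
  have hg : Equiv.swap v i * Equiv.swap i j * Equiv.swap v j ∈ fixing (insert v K) := by
    rw [mem_fixing]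
    intro k hk
    rcases Finset.mem_insert.1 hk with rfl | hk'
    · simp
    · have h1 : k ≠ v := fun h => hv (h ▸ hk')
      have h2 : k ≠ i := fun h => hi.1 (h ▸ hk')
      have h3 : k ≠ j := fun h => hj.1 (h ▸ hk')
      simp [Equiv.swap_apply_of_ne_of_ne, h1, h2, h3]
  rw [← sum_fixing_mul_right hg fun τ => F (τ * Equiv.swap v j)]
  refine Finset.sum_congr rfl fun τ _ => hF fun x hx => ?_
  have h2 : x ≠ i := by rintro rfl; exact hi.2 hx
  have h3 : x ≠ j := by rintro rfl; exact hj.2 hx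
  simp [Equiv.swap_apply_of_ne_of_ne h2 h3]

/-- A Hölder-type (Brascamp–Lieb) inequality for uniform permutations fixing `K`: the exponents of
the factors that depend on a pair of positions add up to at most one. -/
theorem mean_fixing_prod_rpow_le {D : Type*} [Fintype D] {e : D → ℝ} (he : ∀ d, 0 ≤ e d)
    (K : Finset α) (X : D → Finset α)
    (hpair : ∀ i j, i ≠ j → ∑ d, (if i ∈ X d ∨ j ∈ X d then e d else 0) ≤ 1)
    (F : D → Equiv.Perm α → ℝ) (hpos : ∀ d σ, 0 < F d σ)
    (hF : ∀ d, DependsOnRestriction (X d) (F d)) :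
    (∑ σ ∈ fixing K, ∏ d, F d σ ^ e d) / (fixing K).card ≤
      ∏ d, ((∑ σ ∈ fixing K, F d σ) / (fixing K).card) ^ e d := by
  induction hn : Kᶜ.card generalizing K X F with
  | zero => simp [fixing_of_compl_eq_empty (Finset.card_eq_zero.1 hn)]
  | succ n ih =>
    obtain ⟨v, hv'⟩ : Kᶜ.Nonempty := Finset.card_pos.1 (by omega)
    have hv : v ∉ K := Finset.mem_compl.1 hv'
    have hn' : (insert v K)ᶜ.card = n := by
      rw [Finset.compl_insert, Finset.card_erase_of_mem hv', hn, Nat.add_sub_cancel]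
    set L := insert v K with hL
    have hcL : (0 : ℝ) < (fixing L).card := card_fixing_pos
    have split : ∀ H : Equiv.Perm α → ℝ, (∑ σ ∈ fixing K, H σ) / (fixing K).card =
        (∑ i ∈ Kᶜ, (∑ τ ∈ fixing L, H (τ * Equiv.swap v i)) / (fixing L).card) / Kᶜ.card := by
      intro H
      rw [sum_fixing hv, card_fixing hv, ← Finset.sum_div, div_div, mul_comm]
    have step : ∀ i, (∑ τ ∈ fixing L, ∏ d, F d (τ * Equiv.swap v i) ^ e d) / (fixing L).card ≤
        ∏ d, ((∑ τ ∈ fixing L, F d (τ * Equiv.swap v i)) / (fixing L).card) ^ e d := by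
      intro i
      -- Conditioning on the position `i` of `v` relabels positions by a transposition; the pair
      -- condition is stable under bijections.
      refine ih L (fun d => (X d).map (Equiv.swap v i).toEmbedding) ?_
        (fun d τ => F d (τ * Equiv.swap v i)) (fun d τ => hpos d _)
        (fun d => (hF d).mul_right _) hn'
      intro a b hab
      have h := hpair ((Equiv.swap v i).symm a) ((Equiv.swap v i).symm b)
        ((Equiv.swap v i).symm.injective.ne hab)
      simpa only [Finset.mem_map_equiv] using h
    rw [split]
    simp_rw [split (F _)]
    refine le_trans ?_ (mean_prod_rpow_le ⟨v, hv'⟩ he (fun i _ j _ => hpair i j)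
      (φ := fun d i => (∑ τ ∈ fixing L, F d (τ * Equiv.swap v i)) / (fixing L).card)
      (fun d i _ => div_pos (Finset.sum_pos (fun τ _ => hpos d _) fixing_nonempty) hcL)
      (fun d i hi j hj => by rw [sum_fixing_swap_eq hv (hF d) hi hj]))
    gcongr with i hi
    exact step i

/-- Fixing the points of `K` barely increases the mean of a function that depends on the
restriction to a set disjoint from `K`. -/
theorem mul_mean_fixing_le {F : Equiv.Perm α → ℝ} (hF : DependsOnRestriction X F)
    (h0 : ∀ σ, 0 ≤ F σ) (hK : Disjoint X K) :
    (1 - (X.card * K.card : ℝ) / Fintype.card α) * ((∑ σ ∈ fixing K, F σ) / (fixing K).card) ≤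
      (∑ σ, F σ) / Fintype.card (Equiv.Perm α) := by
  induction K using Finset.induction_on with
  | empty => simp [fixing_empty]
  | insert v K hv ih =>
    have hXK : Disjoint X K := hK.mono_right (Finset.subset_insert _ _)
    have hvX : v ∉ X := fun h => Finset.disjoint_left.1 hK h (Finset.mem_insert_self _ _)
    have ih := ih hXK
    have hmean : 0 ≤ (∑ σ ∈ fixing (insert v K), F σ) / (fixing (insert v K)).card :=
      div_nonneg (Finset.sum_nonneg fun σ _ => h0 σ) (Nat.cast_nonneg _)
    have hall : 0 ≤ (∑ σ, F σ) / Fintype.card (Equiv.Perm α) :=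
      div_nonneg (Finset.sum_nonneg fun σ _ => h0 σ) (Nat.cast_nonneg _)
    have hcard : ((insert v K).card : ℝ) = K.card + 1 := by
      rw [Finset.card_insert_of_notMem hv]; push_cast; rfl
    have hXle : X.card + K.card + 1 ≤ Fintype.card α := by
      have := Finset.card_le_univ (X ∪ insert v K)
      rw [Finset.card_union_of_disjoint hK, Finset.card_insert_of_notMem hv] at this
      omega
    have hXle' : (X.card : ℝ) + K.card + 1 ≤ Fintype.card α := by exact_mod_cast hXle
    have hx0 : (0 : ℝ) ≤ X.card := Nat.cast_nonneg _
    have hk0 : (0 : ℝ) ≤ K.card := Nat.cast_nonneg _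
    set N : ℝ := (Fintype.card α : ℝ) with hN
    have hNpos : 0 < N := by linarith
    set x : ℝ := (X.card : ℝ) with hx
    set k : ℝ := (K.card : ℝ) with hk
    set m' := (∑ σ ∈ fixing (insert v K), F σ) / (fixing (insert v K)).card with hm'
    have hcompl : (Kᶜ.card : ℝ) = N - k := by
      rw [Finset.card_compl, Nat.cast_sub (Finset.card_le_univ K)]
    -- Keep only the positions of `v` outside `X`, where the swap leaves the restriction to `X`
    -- unchanged.
    have hstep : (1 - x / (N - k)) * m' ≤ (∑ σ ∈ fixing K, F σ) / (fixing K).card := by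
      have hc : (0 : ℝ) < (fixing (insert v K)).card := card_fixing_pos
      rw [sum_fixing hv, card_fixing hv, hcompl]
      have hsub : ∑ _i ∈ Kᶜ \ X, ∑ τ ∈ fixing (insert v K), F τ ≤
          ∑ i ∈ Kᶜ, ∑ τ ∈ fixing (insert v K), F (τ * Equiv.swap v i) := by
        refine le_trans (Finset.sum_le_sum fun i hi => le_of_eq ?_)
          (Finset.sum_le_sum_of_subset_of_nonneg Finset.sdiff_subset
            fun i _ _ => Finset.sum_nonneg fun τ _ => h0 _)
        refine Finset.sum_congr rfl fun τ _ => hF fun y hy => ?_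
        rw [Equiv.Perm.mul_apply, Equiv.swap_apply_of_ne_of_ne]
        · rintro rfl; exact hvX hy
        · rintro rfl; exact (Finset.mem_sdiff.1 hi).2 hy
      have hsd : ((Kᶜ \ X).card : ℝ) = N - k - x := by
        have hXc : X ⊆ Kᶜ := fun y hy => Finset.mem_compl.2 (Finset.disjoint_left.1 hXK hy)
        rw [Finset.card_sdiff_of_subset hXc, Nat.cast_sub (Finset.card_le_card hXc), hcompl]
      rw [Finset.sum_const, nsmul_eq_mul, hsd] at hsub
      rw [le_div_iff₀ (mul_pos (by linarith) hc)]
      refine le_trans (le_of_eq ?_) hsub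
      have : N - k ≠ 0 := by linarith
      rw [hm']
      field_simp
    rw [hcard]
    by_cases hβ : 1 - x * k / N ≤ 0
    · refine le_trans (mul_nonpos_of_nonpos_of_nonneg ?_ hmean) hall
      have : x * k / N ≤ x * (k + 1) / N := by gcongr; linarith
      linarith
    · push Not at hβ
      refine le_trans ?_ ((mul_le_mul_of_nonneg_left hstep hβ.le).trans ih)
      rw [← mul_assoc]
      refine mul_le_mul_of_nonneg_right ?_ hmean
      have hNk : 0 < N - k := by linarith
      -- The product of the two factors dominates the new factor because x(x - 1) ≥ 0, which uses
      -- that x is a natural number.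
      have key : (1 - x * k / N) * (1 - x / (N - k)) - (1 - x * (k + 1) / N) =
          x * (x - 1) * k / (N * (N - k)) := by
        field_simp; ring
      have hxx : 0 ≤ x * (x - 1) := by
        rcases Nat.eq_zero_or_pos X.card with h | h
        · simp [hx, h]
        · have : (1 : ℝ) ≤ x := Nat.one_le_cast.2 h
          exact mul_nonneg hx0 (by linarith)
      have : 0 ≤ x * (x - 1) * k / (N * (N - k)) := by positivity
      linarith

theorem mean_fixing_le {F : Equiv.Perm α → ℝ} (hF : DependsOnRestriction X F)
    (h0 : ∀ σ, 0 ≤ F σ) (h1 : ∀ σ, F σ ≤ 1) (hK : Disjoint X K) :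
    (∑ σ ∈ fixing K, F σ) / (fixing K).card ≤
      (∑ σ, F σ) / Fintype.card (Equiv.Perm α) + (X.card * K.card : ℝ) / Fintype.card α := by
  have h := mul_mean_fixing_le hF h0 hK
  have hle : (∑ σ ∈ fixing K, F σ) / (fixing K).card ≤ 1 := by
    rw [div_le_one card_fixing_pos]
    simpa using Finset.sum_le_sum fun σ (_ : σ ∈ fixing K) => h1 σ
  have : 0 ≤ (X.card * K.card : ℝ) / Fintype.card α := by positivity
  nlinarith

end fixing

end

/-! ### Exponential moments, change of measure and the entropy cost of advice. -/

noncomputable section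

/-- Hoeffding's lemma for a Bernoulli variable. -/
theorem log_bernoulli_mgf_le {q l : ℝ} (hq0 : 0 ≤ q) (hl : 0 ≤ l) :
    Real.log (1 + q * (Real.exp l - 1)) ≤ q * l + l ^ 2 / 8 := by
  have hpos : ∀ x, 0 ≤ x → 0 < 1 + q * (Real.exp x - 1) := fun x hx => by
    have := Real.one_le_exp hx
    nlinarith [mul_nonneg hq0 (sub_nonneg.2 this)]
  have hden : ∀ x, HasDerivAt (fun y => 1 + q * (Real.exp y - 1)) (q * Real.exp x) x := fun x =>
    (((Real.hasDerivAt_exp x).sub_const 1).const_mul q).const_add 1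
  -- This is the derivative of the gap; its own derivative is 1/4 - p(1 - p), with p the tilted
  -- weight, hence nonnegative.
  set ψ₁ : ℝ → ℝ := fun x => q + x / 4 - q * Real.exp x / (1 + q * (Real.exp x - 1)) with hψ₁
  have hd₁ : ∀ x, 0 ≤ x → HasDerivAt ψ₁ (1 / 4 - (q * Real.exp x * (1 + q * (Real.exp x - 1)) -
      q * Real.exp x * (q * Real.exp x)) / (1 + q * (Real.exp x - 1)) ^ 2) x := fun x hx =>
    (((hasDerivAt_id x).div_const 4).const_add q).sub
      (((Real.hasDerivAt_exp x).const_mul q).div (hden x) (hpos x hx).ne')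
  have hψ₁0 : ∀ x, 0 ≤ x → 0 ≤ ψ₁ x := by
    intro x hx
    have hm : MonotoneOn ψ₁ (Set.Ici 0) := by
      refine monotoneOn_of_hasDerivWithinAt_nonneg (convex_Ici 0)
        (fun r hr => (hd₁ r hr).continuousAt.continuousWithinAt)
        (fun r hr => (hd₁ r (interior_subset hr)).hasDerivWithinAt) ?_
      intro r hr
      have hr := hpos r (interior_subset hr)
      rw [sub_nonneg, div_le_iff₀ (by positivity)]
      nlinarith [sq_nonneg (1 + q * (Real.exp r - 1) - 2 * (q * Real.exp r))]
    have h := hm Set.self_mem_Ici hx hx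
    simpa [hψ₁] using h
  have hd : ∀ x, 0 ≤ x → HasDerivAt
      (fun x => q * x + x ^ 2 / 8 - Real.log (1 + q * (Real.exp x - 1))) (ψ₁ x) x := by
    intro x hx
    refine ((((hasDerivAt_id x).const_mul q).add ((hasDerivAt_pow 2 x).div_const 8)).sub
      ((hden x).log (hpos x hx).ne')).congr_deriv ?_
    simp only [hψ₁]
    push_cast
    ring
  have hm : MonotoneOn (fun x => q * x + x ^ 2 / 8 - Real.log (1 + q * (Real.exp x - 1)))
      (Set.Ici 0) :=
    monotoneOn_of_hasDerivWithinAt_nonneg (convex_Ici 0)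
      (fun r hr => (hd r hr).continuousAt.continuousWithinAt)
      (fun r hr => (hd r (interior_subset hr)).hasDerivWithinAt)
      fun r hr => hψ₁0 r (interior_subset hr)
  have h := hm Set.self_mem_Ici hl hl
  simp only [mul_zero, Real.exp_zero, sub_self, add_zero, Real.log_one] at h
  norm_num at h
  linarith

/-- The mean of a function over a set is at most the logarithm of its exponential moment. -/
theorem sum_le_card_mul_log {Ω : Type*} {A C : Finset Ω} (hA : A.Nonempty) (hAC : A ⊆ C)
    (Y : Ω → ℝ) {M : ℝ} (hM : (∑ σ ∈ C, Real.exp (Y σ)) / C.card ≤ M) :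
    (∑ σ ∈ A, Y σ) / A.card ≤ Real.log ((C.card : ℝ) / A.card) + Real.log M := by
  have ha : (0 : ℝ) < A.card := by exact_mod_cast hA.card_pos
  have hc : (0 : ℝ) < C.card := by exact_mod_cast (hA.mono hAC).card_pos
  have hM0 : 0 < M := lt_of_lt_of_le
    (div_pos (Finset.sum_pos (fun σ _ => Real.exp_pos _) (hA.mono hAC)) hc) hM
  set R : ℝ := (C.card : ℝ) / A.card * M with hR
  have hR0 : 0 < R := by positivity
  rw [← Real.log_mul (by positivity) hM0.ne', ← hR, div_le_iff₀ ha]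
  have h1 : ∀ σ, Y σ ≤ Real.exp (Y σ) / R + (Real.log R - 1) := by
    intro σ
    have := Real.log_le_sub_one_of_pos (div_pos (Real.exp_pos (Y σ)) hR0)
    rw [Real.log_div (Real.exp_pos _).ne' hR0.ne', Real.log_exp] at this
    linarith
  have h2 : ∑ σ ∈ A, Real.exp (Y σ) / R ≤ A.card := by
    rw [← Finset.sum_div, div_le_iff₀ hR0]
    calc _ ≤ ∑ σ ∈ C, Real.exp (Y σ) :=
          Finset.sum_le_sum_of_subset_of_nonneg hAC fun σ _ _ => (Real.exp_pos _).le
      _ ≤ M * C.card := (div_le_iff₀ hc).1 hM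
      _ = A.card * R := by rw [hR]; field_simp
  have h3 := Finset.sum_le_sum fun σ (_ : σ ∈ A) => h1 σ
  rw [Finset.sum_add_distrib, Finset.sum_const, nsmul_eq_mul] at h3
  nlinarith

/-- Averaging over the fibres of a map preserves sums. -/
theorem sum_mean_fiber {Ω κ : Type*} [Fintype Ω] [DecidableEq κ] (key : Ω → κ) (φ : Ω → ℝ) :
    ∑ σ, (∑ τ with key τ = key σ, φ τ) / (Finset.univ.filter fun τ => key τ = key σ).card =
      ∑ σ, φ σ := by
  have h : ∀ σ, (∑ τ with key τ = key σ, φ τ) / (Finset.univ.filter fun τ => key τ = key σ).card =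
      ∑ τ, if key τ = key σ then
        φ τ / (Finset.univ.filter fun ρ => key ρ = key τ).card else 0 := by
    intro σ
    rw [Finset.sum_div, Finset.sum_filter]
    refine Finset.sum_congr rfl fun τ _ => ?_
    split_ifs with h
    · rw [h]
    · rfl
  simp_rw [h]
  rw [Finset.sum_comm]
  refine Finset.sum_congr rfl fun τ _ => ?_
  have hpos : (0 : ℝ) < (Finset.univ.filter fun ρ => key ρ = key τ).card := by
    exact_mod_cast Finset.card_pos.2 ⟨τ, by simp⟩
  rw [← Finset.sum_filter, Finset.sum_const, nsmul_eq_mul]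
  rw [Finset.filter_congr fun ρ _ => eq_comm (a := key τ)]
  field_simp

/-- Refining each of the partitions `key z` of `Ω` by the value of `prep` shrinks the cells by a
factor whose mean is at most the number of values of `prep`. -/
theorem sum_card_div_card_le {Ω ζ κ : Type*} [Fintype Ω] [Fintype ζ] [DecidableEq ζ]
    [DecidableEq κ] (prep : Ω → ζ) (key : ζ → Ω → κ) :
    ∑ σ, ((Finset.univ.filter fun τ => key (prep σ) τ = key (prep σ) σ).card : ℝ) /
        (Finset.univ.filter fun τ => prep τ = prep σ ∧ key (prep σ) τ = key (prep σ) σ).card ≤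
      Fintype.card ζ * Fintype.card Ω := by
  set a : Ω → ℝ := fun σ => ((Finset.univ.filter fun τ =>
    prep τ = prep σ ∧ key (prep σ) τ = key (prep σ) σ).card : ℝ) with ha
  have h : ∀ σ, ((Finset.univ.filter fun τ => key (prep σ) τ = key (prep σ) σ).card : ℝ) / a σ =
      ∑ z, ∑ τ, if prep σ = z ∧ key z σ = key z τ then 1 / a σ else 0 := by
    intro σ
    rw [Finset.sum_eq_single (prep σ)]
    · simp only [true_and]
      rw [← Finset.sum_filter, Finset.sum_const, nsmul_eq_mul, mul_one_div,
        Finset.filter_congr fun τ _ => eq_comm (a := key (prep σ) σ)]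
    · intro z _ hz
      exact Finset.sum_eq_zero fun τ _ => if_neg fun hh => hz hh.1.symm
    · simp
  refine (Finset.sum_congr rfl fun σ _ => h σ).trans_le ?_
  rw [Finset.sum_comm]
  -- The nonzero terms range over a single cell and are all the reciprocal of its size.
  have hone : ∀ z τ, (∑ σ, if prep σ = z ∧ key z σ = key z τ then 1 / a σ else 0) ≤ 1 := by
    intro z τ
    rw [← Finset.sum_filter]
    set s := Finset.univ.filter fun σ => prep σ = z ∧ key z σ = key z τ with hs
    have e : ∀ σ ∈ s, 1 / a σ = 1 / s.card := by
      intro σ hσ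
      obtain ⟨rfl, h2⟩ := (Finset.mem_filter.1 hσ).2
      rw [ha, hs]
      simp only [h2]
    rw [Finset.sum_congr rfl e, Finset.sum_const, nsmul_eq_mul, mul_one_div]
    exact div_self_le_one _
  calc _ ≤ ∑ _z : ζ, ∑ _τ : Ω, (1 : ℝ) :=
        Finset.sum_le_sum fun z _ =>
          Finset.sum_comm.trans_le (Finset.sum_le_sum fun τ _ => hone z τ)
    _ = _ := by simp

/-- Concavity of the logarithm, through its tangent at the number of advice values, applied to
`sum_card_div_card_le`. -/
theorem sum_log_card_div_card_le {Ω ζ κ : Type*} [Fintype Ω] [Fintype ζ] [Nonempty ζ]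
    [DecidableEq ζ] [DecidableEq κ] (prep : Ω → ζ) (key : ζ → Ω → κ) :
    ∑ σ, Real.log (((Finset.univ.filter fun τ => key (prep σ) τ = key (prep σ) σ).card : ℝ) /
        (Finset.univ.filter fun τ => prep τ = prep σ ∧ key (prep σ) τ = key (prep σ) σ).card) ≤
      Fintype.card Ω * Real.log (Fintype.card ζ) := by
  have hz : (0 : ℝ) < Fintype.card ζ := by exact_mod_cast Fintype.card_pos
  have h := sum_card_div_card_le prep key
  set ρ : Ω → ℝ := fun σ =>
    ((Finset.univ.filter fun τ => key (prep σ) τ = key (prep σ) σ).card : ℝ) /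
      (Finset.univ.filter fun τ => prep τ = prep σ ∧ key (prep σ) τ = key (prep σ) σ).card with hρ
  have hpos : ∀ σ, 0 < ρ σ := fun σ => by
    refine div_pos ?_ ?_ <;> exact_mod_cast Finset.card_pos.2 ⟨σ, by simp⟩
  have h1 : ∀ σ, Real.log (ρ σ) ≤ ρ σ / Fintype.card ζ + (Real.log (Fintype.card ζ) - 1) := by
    intro σ
    have := Real.log_le_sub_one_of_pos (div_pos (hpos σ) hz)
    rw [Real.log_div (hpos σ).ne' hz.ne'] at this
    linarith
  have h3 := Finset.sum_le_sum fun σ (_ : σ ∈ Finset.univ) => h1 σ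
  rw [Finset.sum_add_distrib, Finset.sum_const, nsmul_eq_mul, ← Finset.sum_div,
    Finset.card_univ] at h3
  have h4 : (∑ σ, ρ σ) / Fintype.card ζ ≤ Fintype.card Ω := by
    rw [div_le_iff₀ hz]; linarith
  linarith

end

/-! ### The moment bound for families of events, and its application to the game. -/

noncomputable section

/-- The exponential-moment bound for a family of events under the uniform distribution on a subset
`A` of a coset `C` of the group of permutations that fix `K`. -/
theorem mul_sum_mean_le {α D : Type*} [Fintype α] [DecidableEq α] [Fintype D] [Nonempty D]
    {K : Finset α} {σ₀ : Equiv.Perm α} {A C : Finset (Equiv.Perm α)} (hA : A.Nonempty)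
    (hAC : A ⊆ C)
    (hC : ∀ F : Equiv.Perm α → ℝ, ∑ τ ∈ C, F τ = ∑ τ ∈ fixing K, F (σ₀ * τ))
    {X : D → Finset α} {P : D → Equiv.Perm α → Bool} (hP : ∀ d, DependsOnRestriction (X d) (P d))
    {c : ℝ} (hc : 0 < c)
    (hpair : ∀ i j, ((Finset.univ.filter fun d => i ∈ X d ∨ j ∈ X d).card : ℝ) ≤
      c * Fintype.card D) (l : ℝ) :
    l * ∑ d, (∑ τ ∈ A, if P d τ then (1 : ℝ) else 0) / A.card ≤
      c * Fintype.card D * Real.log ((C.card : ℝ) / A.card) +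
      ∑ d, Real.log (1 + (∑ τ ∈ C, if P d τ then (1 : ℝ) else 0) / C.card * (Real.exp l - 1)) := by
  have hD : (0 : ℝ) < Fintype.card D := by exact_mod_cast Fintype.card_pos
  have hcD : 0 < c * Fintype.card D := mul_pos hc hD
  -- With equal exponents 1/(c|D|), the count in `hpair` is exactly the pair condition.
  set e : ℝ := (c * Fintype.card D)⁻¹ with he
  have he0 : 0 < e := inv_pos.2 hcD
  set I : D → Equiv.Perm α → ℝ := fun d τ => if P d τ then 1 else 0 with hI
  have hIdep : ∀ d, DependsOnRestriction (X d) (I d) := fun d =>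
    (hP d).comp fun b : Bool => if b then (1 : ℝ) else 0
  have hcard : (C.card : ℝ) = (fixing K).card := by simpa using hC fun _ => 1
  have hCpos : (0 : ℝ) < C.card := by exact_mod_cast (hA.mono hAC).card_pos
  have hfin := mean_fixing_prod_rpow_le (e := fun _ : D => e) (fun _ => he0.le) K X
    (by
      intro i j _
      rw [← Finset.sum_filter, Finset.sum_const, nsmul_eq_mul, he, ← div_eq_mul_inv,
        div_le_one hcD]
      exact hpair i j)
    (fun d τ => Real.exp (l * I d (σ₀ * τ))) (fun _ _ => Real.exp_pos _)
    (fun d => ((hIdep d).mul_left σ₀).comp fun x => Real.exp (l * x))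
  have hmean : ∀ d, (∑ τ ∈ fixing K, Real.exp (l * I d (σ₀ * τ))) / (fixing K).card =
      1 + (∑ τ ∈ C, I d τ) / C.card * (Real.exp l - 1) := by
    intro d
    rw [← hC fun τ => Real.exp (l * I d τ), ← hcard]
    have : ∀ τ, Real.exp (l * I d τ) = 1 + I d τ * (Real.exp l - 1) := by
      intro τ
      simp only [hI]
      split_ifs <;> simp
    simp only [this, Finset.sum_add_distrib, ← Finset.sum_mul, Finset.sum_const, nsmul_eq_mul]
    field_simp
  have hmpos : ∀ d, 0 < 1 + (∑ τ ∈ C, I d τ) / C.card * (Real.exp l - 1) := fun d => by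
    rw [← hmean]
    exact div_pos (Finset.sum_pos (fun _ _ => Real.exp_pos _) fixing_nonempty) card_fixing_pos
  have hY : ∀ τ, ∏ d, Real.exp (l * I d τ) ^ e = Real.exp (∑ d, e * (l * I d τ)) := by
    intro τ
    rw [Real.exp_sum]
    exact Finset.prod_congr rfl fun d _ => by rw [← Real.exp_mul, mul_comm]
  simp only [hmean, hY] at hfin
  rw [← hcard, ← hC fun τ => Real.exp (∑ d, e * (l * I d τ))] at hfin
  have h := sum_le_card_mul_log hA hAC _ hfin
  rw [Real.log_prod fun d _ => (Real.rpow_pos_of_pos (hmpos d) _).ne',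
    Finset.sum_congr rfl fun d _ => Real.log_rpow (hmpos d) _, ← Finset.mul_sum] at h
  have hL : (∑ τ ∈ A, ∑ d, e * (l * I d τ)) / A.card = e * (l * ∑ d, (∑ τ ∈ A, I d τ) / A.card) := by
    rw [Finset.sum_comm]
    simp only [← Finset.mul_sum, ← Finset.sum_div]
    ring
  rw [hL] at h
  have h' := mul_le_mul_of_nonneg_left h hcD.le
  rw [← mul_assoc, mul_add, ← mul_assoc, ← mul_assoc (c * _) e, he,
    mul_inv_cancel₀ hcD.ne', one_mul, one_mul] at h'
  exact h'

namespace PCGame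

variable {N : ℕ} {D M V : Type*} {G : PCGame N D M V}

/-- The answer to an inner query; outer queries have none. -/
def innerAnswer (σ : Equiv.Perm (Fin N)) : G.Query → Option (Fin N)
  | .inner i => some (σ i)
  | .innerInv _ i => some (σ.symm i)
  | .outer _ => none

/-- The position of the permutation `σ` that an inner query reveals. -/
def revealed (σ : Equiv.Perm (Fin N)) : G.Query → Option (Fin N)
  | .inner i => some i
  | .innerInv _ i => some (σ.symm i)
  | .outer _ => none

/-- The message of an outer query. -/
def outerMessage : G.Query → Option M
  | .outer m => some m
  | _ => none

/-- Replaces the answer to an inner query by the one that the permutation `σ₀` gives. -/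
def splice (σ₀ : Equiv.Perm (Fin N)) : G.Query → Fin N → Fin N
  | .inner i, _ => σ₀ i
  | .innerInv _ i, _ => σ₀.symm i
  | .outer _, a => a

theorem length_revealed_add_length_outerMessage (σ : Equiv.Perm (Fin N)) (L : List G.Query) :
    (L.filterMap (revealed σ)).length + (L.filterMap outerMessage).length = L.length := by
  induction L with
  | nil => rfl
  | cons q L ih =>
    cases q <;> simp only [List.filterMap_cons, revealed, outerMessage, List.length_cons] <;> omega

/-- The positions of `σ` that the inner queries among `L` reveal. -/
def knownPositions (L : List G.Query) (σ : Equiv.Perm (Fin N)) : Finset (Fin N) :=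
  (L.filterMap (revealed σ)).toFinset

/-- The positions at which the outer queries among `L` evaluate the permutation, for the secret
`d`. -/
def outerPositions (L : List G.Query) (d : D) : Finset (Fin N) :=
  ((L.filterMap outerMessage).map (G.tr d)).toFinset

theorem mem_outerPositions {L : List G.Query} {d : D} {x : Fin N} :
    x ∈ outerPositions L d ↔ ∃ m ∈ L.filterMap outerMessage, G.tr d m = x := by
  simp [outerPositions]

/-- An inverse query on i pins the permutation at the position σ⁻¹(i), so forward and inverse
queries alike fix values at known positions, and the cell is a left coset. -/
theorem map_innerAnswer_eq_iff {L : List G.Query} {σ τ : Equiv.Perm (Fin N)} :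
    L.map (innerAnswer τ) = L.map (innerAnswer σ) ↔ ∀ k ∈ knownPositions L σ, τ k = σ k := by
  rw [List.map_inj_left]
  simp only [knownPositions, List.mem_toFinset, List.mem_filterMap]
  constructor
  · rintro h k ⟨q, hq, hk⟩
    have := h q hq
    rcases q with i | ⟨hi, i⟩ | m <;> simp only [revealed, innerAnswer, Option.some.injEq,
      reduceCtorEq] at hk this
    · rw [← hk, this]
    · rw [← hk, ← this, Equiv.apply_symm_apply, this, Equiv.apply_symm_apply]
  · intro h q hq
    rcases q with i | ⟨hi, i⟩ | m
    · simp [innerAnswer, h i ⟨_, hq, rfl⟩]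
    · have := h (σ.symm i) ⟨_, hq, rfl⟩
      rw [Equiv.apply_symm_apply] at this
      simp [innerAnswer, Equiv.symm_apply_eq, this]
    · rfl

theorem sum_cell (L : List G.Query) (σ : Equiv.Perm (Fin N)) (F : Equiv.Perm (Fin N) → ℝ) :
    ∑ τ with L.map (innerAnswer τ) = L.map (innerAnswer σ), F τ =
      ∑ τ ∈ fixing (knownPositions L σ), F (σ * τ) := by
  symm
  refine Finset.sum_equiv (Equiv.mulLeft σ) (fun τ => ?_) fun _ _ => rfl
  rw [Finset.mem_filter, map_innerAnswer_eq_iff, mem_fixing]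
  simp

namespace OnlineAlg

/-- The algorithm that ignores the answers to its inner queries and uses those of `σ₀` instead. -/
def hardwire (A : G.OnlineAlg) (σ₀ : Equiv.Perm (Fin N)) : G.OnlineAlg where
  queries := A.queries
  output l := A.output (List.zipWith (splice σ₀) A.queries l)

variable {W : Type*} {g : D → W} {cmp : W → V → Bool}

theorem succeeds_eq (hsuc : G.ComparesOutputTo g cmp) (A : G.OnlineAlg) (σ : Equiv.Perm (Fin N))
    (d : D) : A.succeeds σ d = cmp (g d) (A.output (A.queries.map (G.answer σ d))) :=
  hsuc _ _ _

theorem hardwire_succeeds_eq (hsuc : G.ComparesOutputTo g cmp) (A : G.OnlineAlg)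
    (σ₀ σ : Equiv.Perm (Fin N)) (d : D) : (A.hardwire σ₀).succeeds σ d =
      cmp (g d) (A.output (A.queries.map fun q => splice σ₀ q (G.answer σ d q))) := by
  rw [succeeds_eq hsuc]
  simp [hardwire, List.zipWith_map_right]

theorem hardwire_succeeds_of_agree (hsuc : G.ComparesOutputTo g cmp) (A : G.OnlineAlg)
    {σ₀ σ : Equiv.Perm (Fin N)}
    (h : A.queries.map (innerAnswer σ) = A.queries.map (innerAnswer σ₀)) (d : D) :
    (A.hardwire σ₀).succeeds σ d = A.succeeds σ d := by
  rw [hardwire_succeeds_eq hsuc, succeeds_eq hsuc]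
  congr 2
  rw [List.map_inj_left] at h ⊢
  intro q hq
  have := h q hq
  cases q <;> simp_all [innerAnswer, splice, answer]

/-- Once inner answers are overwritten, the permutation enters only through the outer queries. -/
theorem dependsOnRestriction_hardwire (hsuc : G.ComparesOutputTo g cmp) (A : G.OnlineAlg)
    (σ₀ : Equiv.Perm (Fin N)) (d : D) :
    DependsOnRestriction (outerPositions A.queries d) fun σ => (A.hardwire σ₀).succeeds σ d := by
  intro σ τ h
  simp only [hardwire_succeeds_eq hsuc]
  congr 2
  rw [List.map_inj_left]
  intro q hq
  rcases q with i | ⟨hi, i⟩ | m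
  · rfl
  · rfl
  · have := h (G.tr d m) (mem_outerPositions.2 ⟨m, List.mem_filterMap.2 ⟨_, hq, rfl⟩, rfl⟩)
    simp [splice, answer, this]

end OnlineAlg

/-! ### Counting with uniformity, and the bounds on cells. -/

section uniform

variable [Fintype D] {u : ℝ}

theorem IsUniform.card_exists_le (htr : G.IsUniform u) (l : List M) (j : Fin N) :
    ((Finset.univ.filter fun d => ∃ m ∈ l, G.tr d m = j).card : ℝ) ≤
      l.length * (Fintype.card D / u) := by
  classical
  induction l with
  | nil => simp
  | cons m l ih =>
    have : (Finset.univ.filter fun d => ∃ a ∈ m :: l, G.tr d a = j) =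
        (Finset.univ.filter fun d => G.tr d m = j) ∪
          Finset.univ.filter fun d => ∃ a ∈ l, G.tr d a = j := by
      ext d; simp
    rw [this]
    have h1 : ((_ ∪ _ : Finset D).card : ℝ) ≤ _ := Nat.cast_le.2 (Finset.card_union_le
      (Finset.univ.filter fun d => G.tr d m = j)
      (Finset.univ.filter fun d => ∃ a ∈ l, G.tr d a = j))
    have h2 := htr m j
    rw [List.length_cons]
    push_cast at h1 ⊢
    linarith

theorem IsUniform.card_mem_outerPositions_le (htr : G.IsUniform u) (L : List G.Query)
    (j : Fin N) : ((Finset.univ.filter fun d => j ∈ outerPositions L d).card : ℝ) ≤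
      (L.filterMap outerMessage).length * (Fintype.card D / u) := by
  classical
  simp only [mem_outerPositions]
  convert htr.card_exists_le (L.filterMap outerMessage) j

theorem IsUniform.card_pair_outerPositions_le (htr : G.IsUniform u) (L : List G.Query)
    (i j : Fin N) :
    ((Finset.univ.filter fun d => i ∈ outerPositions L d ∨ j ∈ outerPositions L d).card : ℝ) ≤
      2 * ((L.filterMap outerMessage).length * (Fintype.card D / u)) := by
  classical
  rw [Finset.filter_or]
  have h1 : ((_ ∪ _ : Finset D).card : ℝ) ≤ _ := Nat.cast_le.2 (Finset.card_union_le
    (Finset.univ.filter fun d => i ∈ outerPositions L d)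
    (Finset.univ.filter fun d => j ∈ outerPositions L d))
  have h2 := htr.card_mem_outerPositions_le L i
  have h3 := htr.card_mem_outerPositions_le L j
  push_cast at h1
  linarith

theorem IsUniform.card_not_disjoint_le (htr : G.IsUniform u) (L : List G.Query)
    (K : Finset (Fin N)) :
    ((Finset.univ.filter fun d => ¬ Disjoint (outerPositions L d) K).card : ℝ) ≤
      K.card * ((L.filterMap outerMessage).length * (Fintype.card D / u)) := by
  classical
  have h : (Finset.univ.filter fun d => ¬ Disjoint (outerPositions L d) K) ⊆
      K.biUnion fun k => Finset.univ.filter fun d => k ∈ outerPositions L d := by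
    intro d hd
    obtain ⟨k, h1, h2⟩ := Finset.not_disjoint_iff.1 (Finset.mem_filter.1 hd).2
    exact Finset.mem_biUnion.2 ⟨k, h2, by simpa using h1⟩
  calc _ ≤ ((∑ k ∈ K, (Finset.univ.filter fun d => k ∈ outerPositions L d).card : ℕ) : ℝ) := by
        exact_mod_cast (Finset.card_le_card h).trans Finset.card_biUnion_le
    _ ≤ ∑ _k ∈ K, ((L.filterMap outerMessage).length * (Fintype.card D / u) : ℝ) := by
        push_cast
        exact Finset.sum_le_sum fun k _ => htr.card_mem_outerPositions_le L k
    _ = _ := by rw [Finset.sum_const, nsmul_eq_mul]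

theorem IsUniform.le_card [Nonempty D] (hu : 0 < u) (htr : G.IsUniform u) (m : M) : u ≤ N := by
  have hD : (0 : ℝ) < Fintype.card D := by exact_mod_cast Fintype.card_pos
  have h := Finset.sum_le_sum fun j (_ : j ∈ (Finset.univ : Finset (Fin N))) => htr m j
  have h2 : (Finset.univ : Finset D).card =
      ∑ j, (Finset.univ.filter fun d => G.tr d m = j).card :=
    Finset.card_eq_sum_card_fiberwise fun d _ => Finset.mem_univ _
  rw [← Nat.cast_sum, ← h2, Finset.card_univ, Finset.sum_const, nsmul_eq_mul, Finset.card_univ,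
    Fintype.card_fin, ← mul_div_assoc, le_div_iff₀ hu, mul_comm] at h
  exact le_of_mul_le_mul_right h hD

theorem OnlineAlg.successProb_le_maxS (A : G.OnlineAlg) {T : ℕ} (hA : A.numQueries ≤ T) :
    A.successProb ≤ G.maxS T :=
  le_csSup (G.bddAbove_successProb T) ⟨A, hA, rfl⟩

theorem PrepAlg.successProb_nonneg {S : ℕ} (A : G.PrepAlg S) : 0 ≤ A.successProb := by
  unfold PrepAlg.successProb
  positivity

variable [Nonempty D] {W : Type*} {g : D → W} {cmp : W → V → Bool}

/-- On a cell of permutations with prescribed answers to the inner queries, an algorithm succeeds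
little more often than an optimal one does on all permutations. -/
theorem sum_mean_cell_le (hN : 0 < N) (hu : 0 < u) (htr : G.IsUniform u)
    (hsuc : G.ComparesOutputTo g cmp) (A : G.OnlineAlg) {T : ℕ} (hA : A.numQueries ≤ T)
    (σ : Equiv.Perm (Fin N)) {C : Finset (Equiv.Perm (Fin N))}
    (hC : ∀ F : Equiv.Perm (Fin N) → ℝ,
      ∑ τ ∈ C, F τ = ∑ τ ∈ fixing (knownPositions A.queries σ), F (σ * τ)) :
    ∑ d, (∑ τ ∈ C, if (A.hardwire σ).succeeds τ d then (1 : ℝ) else 0) / C.card ≤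
      Fintype.card D * (G.maxS T + (T : ℝ) ^ 2 / (2 * u)) := by
  have hD : (0 : ℝ) < Fintype.card D := by exact_mod_cast Fintype.card_pos
  have hN' : (0 : ℝ) < N := by exact_mod_cast hN
  set K := knownPositions A.queries σ with hK
  set t : ℝ := ((A.queries.filterMap outerMessage).length : ℝ) with ht
  set k : ℝ := ((A.queries.filterMap (revealed σ)).length : ℝ) with hk
  have hKk : (K.card : ℝ) ≤ k := Nat.cast_le.2 (List.toFinset_card_le _)
  have ht0 : 0 ≤ t := Nat.cast_nonneg _
  have hk0 : 0 ≤ k := Nat.cast_nonneg _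
  have hkt : k + t ≤ T := by
    rw [hk, ht, ← Nat.cast_add, length_revealed_add_length_outerMessage]
    exact_mod_cast hA
  have hXt : ∀ d, ((outerPositions A.queries d).card : ℝ) ≤ t := fun d =>
    Nat.cast_le.2 ((List.toFinset_card_le _).trans (List.length_map _).le)
  set I : D → Equiv.Perm (Fin N) → ℝ :=
    fun d τ => if (A.hardwire σ).succeeds τ d then 1 else 0 with hI
  have hI0 : ∀ d τ, 0 ≤ I d τ := fun d τ => by simp only [hI]; split_ifs <;> norm_num
  have hI1 : ∀ d τ, I d τ ≤ 1 := fun d τ => by simp only [hI]; split_ifs <;> norm_num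
  have hIdep : ∀ d, DependsOnRestriction (outerPositions A.queries d) (I d) := fun d =>
    (A.dependsOnRestriction_hardwire hsuc σ d).comp fun b : Bool => if b then (1 : ℝ) else 0
  have hcard : (C.card : ℝ) = (fixing K).card := by simpa using hC fun _ => 1
  set a : D → ℝ := fun d => (∑ τ, I d τ) / Fintype.card (Equiv.Perm (Fin N)) with ha
  have ha0 : ∀ d, 0 ≤ a d := fun d =>
    div_nonneg (Finset.sum_nonneg fun τ _ => hI0 d τ) (Nat.cast_nonneg _)
  -- If the outer positions avoid `K`, conditioning costs t·k/N; the secrets for which they meet `K`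
  -- are charged in full and counted by uniformity.
  have hone : ∀ d, (∑ τ ∈ C, I d τ) / C.card ≤
      a d + t * k / N + if ¬ Disjoint (outerPositions A.queries d) K then 1 else 0 := by
    intro d
    rw [hC, hcard]
    by_cases h : Disjoint (outerPositions A.queries d) K
    · rw [if_neg (not_not.2 h)]
      have h1 := mean_fixing_le (K := K) ((hIdep d).mul_left σ) (fun τ => hI0 d _)
        (fun τ => hI1 d _) (h)
      have h2 : ∑ τ, I d (σ * τ) = ∑ τ, I d τ := Equiv.sum_comp (Equiv.mulLeft σ) (I d)
      rw [h2, Fintype.card_fin] at h1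
      have h3 : ((outerPositions A.queries d).card * K.card : ℝ) / N ≤ t * k / N := by
        gcongr
        exact hXt d
      simp only [ha]
      linarith
    · rw [if_pos h]
      have h1 : (∑ τ ∈ fixing K, I d (σ * τ)) / (fixing K).card ≤ 1 := by
        rw [div_le_one card_fixing_pos]
        simpa using Finset.sum_le_sum fun τ (_ : τ ∈ fixing K) => hI1 d (σ * τ)
      have := ha0 d
      have : 0 ≤ t * k / N := by positivity
      linarith
  have hsum_a : ∑ d, a d ≤ Fintype.card D * G.maxS T := by
    have h := (A.hardwire σ).successProb_le_maxS (T := T) hA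
    have e : ∑ d, a d = Fintype.card D * (A.hardwire σ).successProb := by
      simp only [ha, OnlineAlg.successProb, ← Finset.sum_div]
      rw [Finset.sum_comm]
      field_simp
      rfl
    rw [e]
    exact mul_le_mul_of_nonneg_left h hD.le
  -- The bound u ≤ N needs some outer query to exist; without one, t = 0.
  have htk : t * k / N ≤ t * k / u := by
    rcases (A.queries.filterMap outerMessage).eq_nil_or_concat with h | ⟨_, m, _⟩
    · have : t = 0 := by rw [ht, h]; simp
      simp [this]
    · have := htr.le_card hu m
      gcongr
  have hhit : (∑ d, if ¬ Disjoint (outerPositions A.queries d) K then (1 : ℝ) else 0) ≤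
      Fintype.card D * (t * k / u) := by
    rw [← Finset.sum_filter, Finset.sum_const, nsmul_eq_mul, mul_one]
    refine (htr.card_not_disjoint_le A.queries K).trans ?_
    calc (K.card : ℝ) * (t * (Fintype.card D / u)) ≤ k * (t * (Fintype.card D / u)) := by gcongr
      _ = _ := by ring
  -- From 4tk ≤ (t + k)² ≤ T².
  have hquad : t * k / u + t * k / u ≤ (T : ℝ) ^ 2 / (2 * u) := by
    rw [← add_div, div_le_div_iff₀ hu (by positivity)]
    have h4 : 4 * (t * k) ≤ (T : ℝ) ^ 2 := by nlinarith [sq_nonneg (t - k)]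
    nlinarith
  calc _ ≤ ∑ d, (a d + t * k / N +
        if ¬ Disjoint (outerPositions A.queries d) K then 1 else 0) :=
        Finset.sum_le_sum fun d _ => hone d
    _ = ∑ d, a d + Fintype.card D * (t * k / N) +
        ∑ d, if ¬ Disjoint (outerPositions A.queries d) K then 1 else 0 := by
        rw [Finset.sum_add_distrib, Finset.sum_add_distrib, Finset.sum_const, nsmul_eq_mul,
          Finset.card_univ]
    _ ≤ Fintype.card D * G.maxS T + Fintype.card D * (t * k / u) +
        Fintype.card D * (t * k / u) := by gcongr
    _ ≤ _ := by
        rw [← mul_add, ← mul_add, add_assoc]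
        gcongr

/-- The exponential-moment bound for the success probability of an algorithm with advice. -/
theorem PrepAlg.mul_successProb_le (hN : 0 < N) (hu : 0 < u) (htr : G.IsUniform u)
    (hsuc : G.ComparesOutputTo g cmp) {S T : ℕ} (A : G.PrepAlg S) (hA : A.MakesAtMost T)
    {c : ℝ} (hc : 0 < c) (hcT : 2 * T / u ≤ c) {l B : ℝ}
    (hB : ∀ q : D → ℝ, (∀ d, 0 ≤ q d) →
      ∑ d, q d ≤ Fintype.card D * (G.maxS T + (T : ℝ) ^ 2 / (2 * u)) →
      ∑ d, Real.log (1 + q d * (Real.exp l - 1)) ≤ Fintype.card D * B) :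
    l * A.successProb ≤ c * (S * Real.log 2) + B := by
  classical
  have hD : (0 : ℝ) < Fintype.card D := by exact_mod_cast Fintype.card_pos
  set n : ℝ := (Fintype.card (Equiv.Perm (Fin N)) : ℝ) with hn
  have hn0 : 0 < n := by rw [hn]; exact_mod_cast Fintype.card_pos
  set key : (Fin S → Bool) → Equiv.Perm (Fin N) → List (Option (Fin N)) :=
    fun z τ => (A.online z).queries.map (innerAnswer τ) with hkey
  set C : Equiv.Perm (Fin N) → Finset (Equiv.Perm (Fin N)) := fun σ =>
    Finset.univ.filter fun τ => key (A.prep σ) τ = key (A.prep σ) σ with hCdef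
  set E : Equiv.Perm (Fin N) → Finset (Equiv.Perm (Fin N)) := fun σ =>
    Finset.univ.filter fun τ => A.prep τ = A.prep σ ∧ key (A.prep σ) τ = key (A.prep σ) σ with hE
  set I : D → Equiv.Perm (Fin N) → ℝ :=
    fun d τ => if (A.online (A.prep τ)).succeeds τ d then 1 else 0 with hI
  have hcell : ∀ σ, l * ∑ d, (∑ τ ∈ E σ, I d τ) / (E σ).card ≤
      c * Fintype.card D * Real.log ((C σ).card / (E σ).card) + Fintype.card D * B := by
    intro σ
    have hne : (E σ).Nonempty := ⟨σ, by simp [hE]⟩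
    have hsub : E σ ⊆ C σ := fun τ hτ => by
      simp only [hE, hCdef, Finset.mem_filter] at hτ ⊢
      exact ⟨hτ.1, hτ.2.2⟩
    have hCsum : ∀ F : Equiv.Perm (Fin N) → ℝ, ∑ τ ∈ C σ, F τ =
        ∑ τ ∈ fixing (knownPositions (A.online (A.prep σ)).queries σ), F (σ * τ) := fun F => by
      rw [← sum_cell]
    have hpair : ∀ i j, ((Finset.univ.filter fun d =>
        i ∈ outerPositions (A.online (A.prep σ)).queries d ∨
          j ∈ outerPositions (A.online (A.prep σ)).queries d).card : ℝ) ≤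
        c * Fintype.card D := by
      intro i j
      have hT : (((A.online (A.prep σ)).queries.filterMap outerMessage).length : ℝ) ≤ T :=
        Nat.cast_le.2 ((List.length_filterMap_le _ _).trans (hA _))
      calc _ ≤ 2 * ((((A.online (A.prep σ)).queries.filterMap outerMessage).length : ℝ) *
            (Fintype.card D / u)) := by
              convert htr.card_pair_outerPositions_le (A.online (A.prep σ)).queries i j
        _ ≤ 2 * (T * (Fintype.card D / u)) := by gcongr
        _ = 2 * T / u * Fintype.card D := by ring
        _ ≤ _ := by gcongr
    have h := mul_sum_mean_le hne hsub hCsum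
      (fun d => (A.online (A.prep σ)).dependsOnRestriction_hardwire hsuc σ d) hc hpair l
    have hq := hB (fun d => (∑ τ ∈ C σ,
        if ((A.online (A.prep σ)).hardwire σ).succeeds τ d then (1 : ℝ) else 0) / (C σ).card)
      (fun d => by positivity)
      (sum_mean_cell_le hN hu htr hsuc _ (hA _) σ hCsum)
    -- On `E σ` the advice and the inner answers are constant, so the hardwired algorithm agrees
    -- with the real one.
    have hEI : ∀ d, (∑ τ ∈ E σ, if ((A.online (A.prep σ)).hardwire σ).succeeds τ d then
        (1 : ℝ) else 0) = ∑ τ ∈ E σ, I d τ := by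
      intro d
      refine Finset.sum_congr rfl fun τ hτ => ?_
      obtain ⟨h1, h2⟩ := (Finset.mem_filter.1 hτ).2
      rw [OnlineAlg.hardwire_succeeds_of_agree hsuc _ h2]
      simp only [hI, h1]
    simp only [hEI] at h
    linarith
  have hEfib : ∀ σ, E σ = Finset.univ.filter fun τ =>
      (A.prep τ, key (A.prep τ) τ) = (A.prep σ, key (A.prep σ) σ) := by
    intro σ
    ext τ
    simp only [hE, Finset.mem_filter, Finset.mem_univ, true_and, Prod.mk.injEq]
    exact and_congr_right fun h => by rw [h]
  have htotal : ∑ σ, ∑ d, (∑ τ ∈ E σ, I d τ) / (E σ).card =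
      n * Fintype.card D * A.successProb := by
    rw [Finset.sum_comm]
    simp only [hEfib]
    rw [Finset.sum_congr rfl fun d _ => sum_mean_fiber _ (I d), Finset.sum_comm]
    rw [PrepAlg.successProb, mul_div_cancel₀ _ (by positivity)]
  have hlog : ∑ σ, Real.log ((C σ).card / (E σ).card) ≤ n * (S * Real.log 2) := by
    have h := sum_log_card_div_card_le A.prep key
    have e : Real.log (Fintype.card (Fin S → Bool)) = S * Real.log 2 := by
      simp [Real.log_pow]
    rw [e] at h
    exact h
  have h := Finset.sum_le_sum fun σ (_ : σ ∈ Finset.univ) => hcell σ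
  rw [← Finset.mul_sum, htotal, Finset.sum_add_distrib, ← Finset.mul_sum, Finset.sum_const,
    nsmul_eq_mul, Finset.card_univ] at h
  have h2 : c * Fintype.card D * ∑ σ, Real.log ((C σ).card / (E σ).card) ≤
      c * Fintype.card D * (n * (S * Real.log 2)) := by gcongr
  refine le_of_mul_le_mul_left ?_ (mul_pos hn0 hD)
  linarith

/-- The limiting case c = 2T/u, reached from above because c must be positive while T may be 0. -/
theorem PrepAlg.mul_successProb_le' (hN : 0 < N) (hu : 0 < u) (htr : G.IsUniform u)
    (hsuc : G.ComparesOutputTo g cmp) {S T : ℕ} (A : G.PrepAlg S) (hA : A.MakesAtMost T)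
    {l B : ℝ}
    (hB : ∀ q : D → ℝ, (∀ d, 0 ≤ q d) →
      ∑ d, q d ≤ Fintype.card D * (G.maxS T + (T : ℝ) ^ 2 / (2 * u)) →
      ∑ d, Real.log (1 + q d * (Real.exp l - 1)) ≤ Fintype.card D * B) :
    l * A.successProb ≤ 2 * T / u * (S * Real.log 2) + B := by
  have ha : 0 ≤ S * Real.log 2 := mul_nonneg (Nat.cast_nonneg _) (Real.log_nonneg one_le_two)
  refine le_of_forall_pos_le_add fun ε hε => ?_
  set δ := ε / (S * Real.log 2 + 1) with hδ
  have hδ0 : 0 < δ := by positivity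
  have h := A.mul_successProb_le hN hu htr hsuc hA (c := 2 * T / u + δ) (by positivity)
    (by linarith) hB
  have h2 : δ * (S * Real.log 2) ≤ ε := by
    rw [hδ, div_mul_eq_mul_div, div_le_iff₀ (by positivity)]
    nlinarith
  linarith

end uniform

end PCGame

end

/-! ### The theorem: choice of the exponential parameter. -/

theorem theorem4p1 {N : ℕ} (hN : 0 < N) {D M V W : Type*} [Fintype D] [Nonempty D]
    (G : PCGame N D M V) (u : ℝ) (hu : 0 < u) (htr : G.IsUniform u)
    (g : D → W) (cmp : W → V → Bool) (hsuc : G.ComparesOutputTo g cmp)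
    (S T : ℕ) (A : G.PrepAlg S) (hA : A.MakesAtMost T) :
    A.successProb ≤
      min (2 * G.maxS T + 4 * Real.log 2 * (S * T) / u + (T : ℝ) ^ 2 / u)
        (G.maxS T + √(Real.log 2 * (S * T) / u) + (T : ℝ) ^ 2 / (2 * u)) := by
  have hlog2 : 0 ≤ Real.log 2 := Real.log_nonneg one_le_two
  have hΔ : 0 ≤ Real.log 2 * (S * T) / u := by positivity
  have hp := A.successProb_nonneg
  set Q := G.maxS T + (T : ℝ) ^ 2 / (2 * u) with hQ
  refine le_min ?_ ?_
  -- With e^l = 3, log(1 + 2q) ≤ 2q gives the factor 2, and log 3 ≥ 1 lets the left factor be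
  -- dropped. The advice term comes out with constant 2, better than the stated 4.
  · have h := A.mul_successProb_le' hN hu htr hsuc hA (l := Real.log 3) (B := 2 * Q) (by
      intro q hq0 hq
      rw [Real.exp_log (by norm_num)]
      calc _ ≤ ∑ d, 2 * q d := Finset.sum_le_sum fun d _ => by
            have := Real.log_le_sub_one_of_pos (x := 1 + q d * (3 - 1)) (by linarith [hq0 d])
            linarith
        _ ≤ _ := by rw [← Finset.mul_sum]; linarith)
    have h3 : 1 ≤ Real.log 3 := by
      rw [Real.le_log_iff_exp_le (by norm_num)]
      exact Real.exp_one_lt_three.le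
    have h4 : A.successProb ≤ Real.log 3 * A.successProb := le_mul_of_one_le_left hp h3
    have e1 : 2 * (T : ℝ) / u * (S * Real.log 2) = 2 * (Real.log 2 * (S * T) / u) := by ring
    have e2 : 4 * Real.log 2 * (S * T) / u = 4 * (Real.log 2 * (S * T) / u) := by ring
    have e3 : 2 * Q = 2 * G.maxS T + (T : ℝ) ^ 2 / u := by rw [hQ]; field_simp
    linarith
  · set δ := A.successProb - Q with hδ
    suffices hsq : δ ≤ √(Real.log 2 * (S * T) / u) by linarith
    rcases le_or_gt δ 0 with h0 | h0
    · exact h0.trans (Real.sqrt_nonneg _)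
    refine Real.le_sqrt_of_sq_le ?_
    -- Hoeffding's lemma gives lδ ≤ 2Δ + l²/8 with Δ = log 2·ST/u; l = 4δ is optimal and yields δ² ≤
    -- Δ.
    have h := A.mul_successProb_le' hN hu htr hsuc hA (l := 4 * δ)
      (B := 4 * δ * Q + (4 * δ) ^ 2 / 8) (by
      intro q hq0 hq
      calc _ ≤ ∑ d, (q d * (4 * δ) + (4 * δ) ^ 2 / 8) := Finset.sum_le_sum fun d _ =>
            log_bernoulli_mgf_le (hq0 d) (by linarith)
        _ = 4 * δ * ∑ d, q d + Fintype.card D * ((4 * δ) ^ 2 / 8) := by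
            rw [Finset.sum_add_distrib, ← Finset.sum_mul, Finset.sum_const, nsmul_eq_mul,
              Finset.card_univ]
            ring
        _ ≤ 4 * δ * (Fintype.card D * Q) + Fintype.card D * ((4 * δ) ^ 2 / 8) := by gcongr
        _ = _ := by ring)
    have e1 : 2 * (T : ℝ) / u * (S * Real.log 2) = 2 * (Real.log 2 * (S * T) / u) := by ring
    have e2 : 4 * δ * A.successProb = 4 * δ * Q + 4 * δ ^ 2 := by rw [hδ]; ring
    nlinarith
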